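/- **Setting.** Let $\mathcal D'$ be the space of real distributions on $\mathbb C$, with the $\sigma$-algebra generated by the pairings $h\mapsto (h,\phi)$ with smooth compactly supported functions $\phi$. A *whole-plane GFF* is a random distribution $h$ such that the variables $(h,\phi)$ form a centered Gaussian process with $$\operatorname{Cov}\big((h,\phi),(h,\psi)\big)=\int_{\mathbb C}\int_{\mathbb C}\phi(z)\psi(w)\log\frac{\max\{|z|,1\}\max\{|w|,1\}}{|z-w|}\,d^2w\,d^2z .$$ A *GFF plus a continuous function* is a random distribution $\widetilde h+f$ where $\widetilde h$ is a whole-plane GFF and $f:\mathbb C\to\mathbb R$ is a random continuous function, possibly depending on $\widetilde h$. For a metric $d$ on $\mathbb C$ inducing the Euclidean topology, $\operatorname{len}(P;d)=\sup\sum_i d(P(t_i),P(t_{i-1}))$ is the $d$-length of a path $P$, and $d(u,v;U)$ is the infimum of the $d$-lengths of the paths from $u$ to $v$ in the open set $U$. For $f:\mathbb C\to\mathbb R$ continuous let $$(e^{\xi f}\cdot d)(u,v)=\inf_P\int_0^{\operatorname{len}(P;d)}e^{\xi f(P(t))}\,dt ,$$ the infimum being over paths $P$ from $u$ to $v$ parametrized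 by $d$-length. Let $\gamma\in(0,2)$, $Q=\frac2\gamma+\frac\gamma2$, and $\xi>0$ (for the $\gamma$-LQG metric, $\xi=\gamma/d_\gamma$ where $d_\gamma$ is the dimension exponent of $\gamma$-LQG; the statement holds for every value $\xi>0$). An *LQG metric* with parameters $\gamma,\xi$ is a measurable map $h\mapsto D_h$ from $\mathcal D'$ to the space of metrics on $\mathbb C$ which induce the Euclidean topology such that, whenever $h$ is a GFF plus a continuous function: 1. almost surely, $D_h$ is a length metric, i.e. $D_h(u,v)=\inf\{\operatorname{len}(P;D_h): P \text{ a path from } u \text{ to } v\}$ for all $u,v$; 2. for each deterministic open $U\subset\mathbb C$, the internal metric $D_h(\cdot,\cdot;U)$ is almost surely given by a measurable function of $h|_U$; 3. almost surely, $e^{\xi f}\cdot D_h=D_{h+f}$ for every continuous $f:\mathbb C\to\mathbb R$; 4. for each deterministic $r>0$ and $z\in\mathbb C$, almost surely $D_h(ru+z,rv+z)=D_{h(r\cdot+z)+Q\log r}(u,v)$ for all $u,v\in\mathbb C$. A *$D_h$-geodesic* from $z$ to $w$ is a path from $z$ to $w$ of finite and minimal $D_h$-length; paths that differ by a reparametrization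 are identified. **Lemma.** Let $\gamma\in(0,2)$ and $\xi>0$, let $D$ be an LQG metric with parameters $\gamma,\xi$, let $h$ be a whole-plane GFF, and let $z,w\in\mathbb C$ be fixed distinct points. Then almost surely there is a unique $D_h$-geodesic from $z$ to $w$: there are $L\ge 0$ and a path $P:[0,L]\to\mathbb C$ from $z$ to $w$, parametrized by $D_h$-length, such that the $D_h$-geodesics $[0,1]\to\mathbb C$ from $z$ to $w$ are exactly the paths $P\circ\sigma$ with $\sigma:[0,1]\to[0,L]$ continuous, nondecreasing and surjective. -/

import Mathlib

open MeasureTheory ProbabilityTheory Set TopologicalSpace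
open scoped Distributions ENNReal

namespace LQG

/-! ### Distributions on the plane -/

/-- The cylinder σ-algebra on the space of distributions on an open set `U` of the plane: the
smallest one for which all pairings `T ↦ T φ` with test functions are measurable. It is the Borel
σ-algebra of the weak topology. -/
noncomputable instance distributionMeasurableSpace (U : Opens ℂ) : MeasurableSpace 𝓓'(U, ℝ) :=
  ⨆ φ : 𝓓(U, ℝ), MeasurableSpace.comap (fun T : 𝓓'(U, ℝ) => T φ) inferInstance

/-- The space `𝓓'` of distributions on the whole plane. -/
abbrev PlaneDistribution : Type := 𝓓'((⊤ : Opens ℂ), ℝ)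

/-- A continuous function `f`, viewed as the distribution `φ ↦ ∫ φ f`. -/
noncomputable def ofContinuous (f : C(ℂ, ℝ)) : PlaneDistribution :=
  ContinuousLinearMap.toUniformConvergenceCLM _ _ _
    (TestFunction.integralAgainstBilinCLM (ContinuousLinearMap.mul ℝ ℝ) volume f)

/-- The defining formula of `ofContinuous`. -/
theorem ofContinuous_apply (f : C(ℂ, ℝ)) (φ : 𝓓((⊤ : Opens ℂ), ℝ)) :
    ofContinuous f φ = ∫ x, φ x * f x := by
  have h : LocallyIntegrableOn f ((⊤ : Opens ℂ) : Set ℂ) (volume : Measure ℂ) :=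
    f.continuous.locallyIntegrable.locallyIntegrableOn _
  exact TestFunction.integralAgainstBilinCLM_eq_integral h

/-- The restriction `T|_U` of a distribution `T` to an open set `U`: the test functions supported
in `U`, extended by zero, are test functions on the plane. -/
noncomputable def restrict (U : Opens ℂ) (T : PlaneDistribution) : 𝓓'(U, ℝ) :=
  ContinuousLinearMap.precompCompactConvergenceCLM ℝ
    (TestFunction.monoCLM ℝ : 𝓓(U, ℝ) →L[ℝ] 𝓓((⊤ : Opens ℂ), ℝ)) T

/-- For `r > 0`, the test function `x ↦ r⁻² φ((x - z) / r)`. -/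
noncomputable def rescaleTest (r : ℝ) (hr : 0 < r) (z : ℂ) (φ : 𝓓((⊤ : Opens ℂ), ℝ)) :
    𝓓((⊤ : Opens ℂ), ℝ) where
  toFun x := (r ^ 2)⁻¹ * φ (r⁻¹ • (x - z))
  contDiff' := contDiff_const.mul
    (φ.contDiff.comp ((contDiff_id.sub contDiff_const).const_smul r⁻¹))
  hasCompactSupport' := by
    have h : HasCompactSupport fun x : ℂ => φ (r⁻¹ • (x - z)) :=
      φ.hasCompactSupport.comp_homeomorph
        ((Homeomorph.subRight z).trans (Homeomorph.smulOfNeZero r⁻¹ (inv_ne_zero hr.ne')))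
    exact h.mul_left
  tsupport_subset' := fun _ _ => trivial

/-- `rescaleTest` as a continuous linear map on the space of test functions. -/
noncomputable def rescaleTestCLM (r : ℝ) (hr : 0 < r) (z : ℂ) :
    𝓓((⊤ : Opens ℂ), ℝ) →L[ℝ] 𝓓((⊤ : Opens ℂ), ℝ) :=
  TestFunction.mkCLM ℝ (rescaleTest r hr z)
    (fun f g => by
      ext x
      exact mul_add _ _ _)
    (fun c f => by
      ext x
      exact mul_left_comm _ _ _)
    (fun K _ => by
      let A : C(ℂ, ℂ) := ⟨fun x => r⁻¹ • (x - z), by fun_prop⟩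
      let K' : Compacts ℂ := ⟨(fun y : ℂ => r • y + z) '' K, K.isCompact.image (by fun_prop)⟩
      let T : 𝓓_{K}(ℂ, ℝ) → 𝓓_{K'}(ℂ, ℝ) := fun f =>
        { toFun := fun x => (r ^ 2)⁻¹ * f (r⁻¹ • (x - z))
          contDiff' := contDiff_const.mul
            (f.contDiff.comp ((contDiff_id.sub contDiff_const).const_smul r⁻¹))
          zero_on_compl' := by
            intro x hx
            have : r⁻¹ • (x - z) ∉ K := fun h => hx ⟨_, h, by simp [hr.ne']⟩
            have h0 := f.zero_on_compl this
            simp only [Pi.zero_apply] at h0 ⊢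
            rw [h0, mul_zero] }
      have hT : Continuous T := by
        rw [ContDiffMapSupportedIn.continuous_iff_comp]
        intro i
        have key : (ContDiffMapSupportedIn.structureMapCLM ℝ ⊤ i ∘ T) =
            fun f : 𝓓_{K}(ℂ, ℝ) =>
            ((r ^ 2)⁻¹ * r⁻¹ ^ i) •
              (ContDiffMapSupportedIn.structureMapCLM ℝ ⊤ i f).compContinuous A := by
          funext f
          ext1 x
          have hf : ContDiff ℝ i f := f.contDiff.of_le (by exact_mod_cast le_top)
          have hf' : ContDiff ℝ i (fun y => f (r⁻¹ • y)) :=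
            hf.comp (contDiff_id.const_smul r⁻¹)
          have e : (T f : ℂ → ℝ) = (r ^ 2)⁻¹ • fun x => (fun y => f (r⁻¹ • y)) (x - z) := rfl
          have hf'' : ContDiffAt ℝ i (fun x => (fun y => f (r⁻¹ • y)) (x - z)) x :=
            (hf'.comp (contDiff_id.sub contDiff_const)).contDiffAt
          simp only [Function.comp_apply, ContDiffMapSupportedIn.structureMapCLM_top_apply,
            BoundedContinuousFunction.coe_smul, BoundedContinuousFunction.compContinuous_apply]
          rw [e, iteratedFDeriv_const_smul_apply hf'',
            iteratedFDeriv_comp_sub (f := fun y => f (r⁻¹ • y)),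
            iteratedFDeriv_comp_const_smul _ hf, mul_smul]
          rfl
        rw [key]
        have hc := (BoundedContinuousFunction.continuous_compContinuous
          (β := ℂ [×i]→L[ℝ] ℝ) A).comp
          (ContDiffMapSupportedIn.structureMapCLM ℝ (E := ℂ) (F := ℝ) (K := K) ⊤ i).continuous
        exact Continuous.const_smul hc ((r ^ 2)⁻¹ * r⁻¹ ^ i)
      have hK' : (K' : Set ℂ) ⊆ ((⊤ : Opens ℂ) : Set ℂ) := fun _ _ => trivial
      exact (TestFunction.continuous_ofSupportedIn hK').comp hT)

/-- The distribution `T(r · + z)` for `r > 0`, i.e. the composition of `T` with the affine map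
`u ↦ r u + z`. By a change of variables it is `φ ↦ T (x ↦ r⁻² φ((x - z) / r))`. -/
noncomputable def affineComp (r : ℝ) (hr : 0 < r) (z : ℂ) (T : PlaneDistribution) :
    PlaneDistribution :=
  ContinuousLinearMap.precompCompactConvergenceCLM ℝ (rescaleTestCLM r hr z) T

/-- The defining formula of `affineComp`. -/
theorem affineComp_apply (r : ℝ) (hr : 0 < r) (z : ℂ) (T : PlaneDistribution)
    (φ : 𝓓((⊤ : Opens ℂ), ℝ)) : affineComp r hr z T φ = T (rescaleTest r hr z φ) :=
  rfl

/-! ### Metrics on the plane -/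

/-- A metric on the plane which induces the Euclidean topology. -/
structure PlaneMetric where
  /-- The distance function. -/
  dist : ℂ → ℂ → ℝ
  dist_self : ∀ x, dist x x = 0
  eq_of_dist_eq_zero : ∀ x y, dist x y = 0 → x = y
  dist_comm : ∀ x y, dist x y = dist y x
  dist_triangle : ∀ x y z, dist x z ≤ dist x y + dist y z
  isOpen_iff : ∀ s : Set ℂ, IsOpen s ↔ ∀ x ∈ s, ∃ ε > 0, ∀ y, dist x y < ε → y ∈ s

namespace PlaneMetric

/-- The σ-algebra on the space of metrics generated by the distances between pairs of points. It is
the Borel σ-algebra of the topology of uniform convergence on compact subsets of `ℂ × ℂ`. -/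
noncomputable instance : MeasurableSpace PlaneMetric :=
  ⨆ p : ℂ × ℂ, MeasurableSpace.comap (fun d : PlaneMetric => d.dist p.1 p.2) inferInstance

/-- The metric space structure on `ℂ` with distance function `d`. -/
@[reducible]
noncomputable def toMetricSpace (d : PlaneMetric) : MetricSpace ℂ :=
  MetricSpace.ofDistTopology d.dist d.dist_self d.dist_comm d.dist_triangle d.isOpen_iff
    d.eq_of_dist_eq_zero

/-- The `d`-length of a path `P` restricted to a set `s` of times: the supremum of
`∑ d(P(t_i), P(t_{i-1}))` over all finite increasing sequences of times `t_i` in `s`. -/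
noncomputable def length (d : PlaneMetric) {ι : Type*} [LinearOrder ι] (P : ι → ℂ) (s : Set ι) :
    ℝ≥0∞ :=
  @eVariationOn ι _ ℂ d.toMetricSpace.toPseudoMetricSpace.toPseudoEMetricSpace P s

/-- The `d`-length of a continuous path `γ : [0, 1] → ℂ`. -/
noncomputable def pathLength (d : PlaneMetric) {z w : ℂ} (γ : Path z w) : ℝ≥0∞ :=
  d.length γ univ

/-- `d` is a length metric: distances are infima of the lengths of paths. -/
def IsLengthMetric (d : PlaneMetric) : Prop :=
  ∀ z w : ℂ, ENNReal.ofReal (d.dist z w) = ⨅ γ : Path z w, d.pathLength γ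

/-- The internal metric `d(z, w; U)`: the infimum of the lengths of the paths from `z` to `w` in
`U` (it is `∞` if there is no such path of finite length). -/
noncomputable def internal (d : PlaneMetric) (U : Set ℂ) (z w : ℂ) : ℝ≥0∞ :=
  ⨅ (γ : Path z w) (_ : ∀ t, γ t ∈ U), d.pathLength γ

/-- `P` is, on the time interval `[0, L]`, a path from `z` to `w` parametrized by `d`-length; in
particular its length is `L`. -/
structure IsLengthParam (d : PlaneMetric) (z w : ℂ) (L : ℝ) (P : ℝ → ℂ) : Prop where
  nonneg : 0 ≤ L
  continuousOn : ContinuousOn P (Icc 0 L)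
  source : P 0 = z
  target : P L = w
  length_eq : ∀ s t : ℝ, 0 ≤ s → s ≤ t → t ≤ L → d.length P (Icc s t) = ENNReal.ofReal (t - s)

/-- The distances `(e^{ξ f} · d)(z, w) = inf_P ∫_0^{len(P; d)} e^{ξ f(P(t))} dt`, where the infimum
is over all paths `P` from `z` to `w` parametrized by `d`-length. -/
noncomputable def weyl (ξ : ℝ) (f : C(ℂ, ℝ)) (d : PlaneMetric) (z w : ℂ) : ℝ≥0∞ :=
  ⨅ (L : ℝ) (P : ℝ → ℂ) (_ : d.IsLengthParam z w L P),
    ∫⁻ t in Icc 0 L, ENNReal.ofReal (Real.exp (ξ * f (P t)))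

/-- `γ` is a `d`-geodesic from `z` to `w`: a path of (finite and) minimal `d`-length. -/
def IsGeodesic (d : PlaneMetric) {z w : ℂ} (γ : Path z w) : Prop :=
  d.pathLength γ ≠ ∞ ∧ ∀ γ' : Path z w, d.pathLength γ ≤ d.pathLength γ'

/-- There is a unique `d`-geodesic from `z` to `w`, where paths are considered up to
reparametrization: there is a path `P : [0, L] → ℂ` from `z` to `w`, parametrized by `d`-length,
such that the geodesics from `z` to `w` are exactly the paths `P ∘ σ` with `σ` a continuous
nondecreasing map from `[0, 1]` onto `[0, L]`. -/
def HasUniqueGeodesic (d : PlaneMetric) (z w : ℂ) : Prop :=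
  ∃ (L : ℝ) (P : ℝ → ℂ), d.IsLengthParam z w L P ∧
    ∀ γ : Path z w, d.IsGeodesic γ ↔
      ∃ σ : unitInterval → ℝ, Continuous σ ∧ Monotone σ ∧ σ 0 = 0 ∧ σ 1 = L ∧ ∀ t, γ t = P (σ t)

end PlaneMetric

/-! ### The whole-plane Gaussian free field -/

/-- The covariance kernel of the whole-plane GFF normalized to have average zero over the unit
circle. -/
noncomputable def greenFunction (z w : ℂ) : ℝ :=
  Real.log (max ‖z‖ 1 * max ‖w‖ 1 / ‖z - w‖)

/-- The random distribution `h` is a whole-plane Gaussian free field: the variables `(h, φ)` form a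
centered Gaussian process with covariances `∫∫ φ(z) ψ(w) G(z, w) dz dw`. -/
structure IsWholePlaneGFF {Ω : Type*} [MeasurableSpace Ω] (μ : Measure Ω)
    (h : Ω → PlaneDistribution) : Prop where
  measurable : Measurable h
  gaussian : IsGaussianProcess (fun (φ : 𝓓((⊤ : Opens ℂ), ℝ)) (ω : Ω) => h ω φ) μ
  centered : ∀ φ : 𝓓((⊤ : Opens ℂ), ℝ), ∫ ω, h ω φ ∂μ = 0
  covariance_eq : ∀ φ ψ : 𝓓((⊤ : Opens ℂ), ℝ),
    covariance (fun ω => h ω φ) (fun ω => h ω ψ) μ =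
      ∫ z : ℂ, ∫ w : ℂ, φ z * ψ w * greenFunction z w

/-- The random distribution `h` is a whole-plane GFF plus a (possibly random, and possibly
dependent on the GFF) continuous function. -/
def IsGFFPlusContinuous {Ω : Type*} [MeasurableSpace Ω] (μ : Measure Ω)
    (h : Ω → PlaneDistribution) : Prop :=
  ∃ (h₀ : Ω → PlaneDistribution) (f : Ω → C(ℂ, ℝ)), IsWholePlaneGFF μ h₀ ∧
    (∀ x : ℂ, Measurable fun ω => f ω x) ∧ ∀ ω, h ω = h₀ ω + ofContinuous (f ω)

/-! ### LQG metrics -/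

/-- A measurable map `h ↦ D_h` from distributions to metrics on the plane inducing the Euclidean
topology is an LQG metric with parameters `γ` and `ξ` if it satisfies the following four axioms
whenever `h` is a whole-plane GFF plus a continuous function. The `γ`-LQG metric is the case
`ξ = γ / d_γ`, with `d_γ` the dimension exponent of `γ`-LQG. -/
structure IsLQGMetric (γ ξ : ℝ) (D : PlaneDistribution → PlaneMetric) : Prop where
  measurable : Measurable D
  /-- Length space. -/
  length_space : ∀ {Ω : Type} [MeasurableSpace Ω] (μ : Measure Ω) [IsProbabilityMeasure μ]
    (h : Ω → PlaneDistribution), IsGFFPlusContinuous μ h →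
    ∀ᵐ ω ∂μ, (D (h ω)).IsLengthMetric
  /-- Locality: the internal metric on `U` is a.s. a measurable function of `h|_U`. -/
  locality : ∀ {Ω : Type} [MeasurableSpace Ω] (μ : Measure Ω) [IsProbabilityMeasure μ]
    (h : Ω → PlaneDistribution), IsGFFPlusContinuous μ h → ∀ U : Opens ℂ,
    ∃ F : 𝓓'(U, ℝ) → U → U → ℝ≥0∞, Measurable F ∧
      ∀ᵐ ω ∂μ, ∀ u v : U, (D (h ω)).internal U u v = F (restrict U (h ω)) u v
  /-- Weyl scaling. -/
  weyl_scaling : ∀ {Ω : Type} [MeasurableSpace Ω] (μ : Measure Ω) [IsProbabilityMeasure μ]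
    (h : Ω → PlaneDistribution), IsGFFPlusContinuous μ h →
    ∀ᵐ ω ∂μ, ∀ (f : C(ℂ, ℝ)) (z w : ℂ),
      (D (h ω)).weyl ξ f z w = ENNReal.ofReal ((D (h ω + ofContinuous f)).dist z w)
  /-- Coordinate change for scaling and translation, with `Q = 2 / γ + γ / 2`. -/
  coordinate_change : ∀ {Ω : Type} [MeasurableSpace Ω] (μ : Measure Ω) [IsProbabilityMeasure μ]
    (h : Ω → PlaneDistribution), IsGFFPlusContinuous μ h → ∀ (r : ℝ) (hr : 0 < r) (z : ℂ),
    ∀ᵐ ω ∂μ, ∀ u v : ℂ,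
      (D (h ω)).dist (r * u + z) (r * v + z) =
        (D (affineComp r hr z (h ω) +
          ofContinuous (ContinuousMap.const ℂ ((2 / γ + γ / 2) * Real.log r)))).dist u v

end LQG

/-!
Both existence and uniqueness are first reduced to statements about one metric `d` on the plane. If
`d`-balls around `z` are bounded in the Euclidean sense, an Arzelà-Ascoli argument gives geodesics
between all pairs of points (`exists_isLengthParam_dist`). A geodesic from `z` to `w` then visits a
point `x` at time `d(z, x)`, so that there is a unique geodesic as soon as any two geodesics which
are parametrized by length agree (`hasUniqueGeodesic_of_eqOn`).

*Existence.* By the scaling axiom, the distance from `z` to the circle of radius `r` around `z` is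
the distance from `0` to the unit circle for the field `h(r · + z) + Q log r`. Up to an additive
constant `h(r · + z)` has the law of `h`, because its covariances against test functions of mean
zero are those of `h`; the constant has variance of order `log r` and is dominated by `Q log r`.
Adding a constant to the field multiplies the metric by a factor, so that large circles are far from
`z` with high probability (`IsLQGMetric.exists_measure_sphere_le`). As the additive constant depends
on the field, its joint law with the recentered field has to be transported to a space on which `h`
itself is defined; this is done by gluing along the conditional law.

*Uniqueness.* Let `f` be a bounded function which is the Green potential of a test function `ψ`. The
distance `g(s)` from `z` to `w` for the field `h + s f` is the infimum of `∫ exp(ξ s f(P(t))) dt`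
over paths `P` parametrized by `D_h`-length. If two geodesics for `h` had different `f`-integrals,
then `g` would have a concave kink at `s = 0` (`hasConcaveKink_of_integral_lt`). But `log g` is
Lipschitz, so `g` is differentiable almost everywhere and kinks occur for a null set of `s` only. As
`h` is the sum of `Z f`, with a Gaussian variable `Z`, and of an independent field, Fubini's theorem
shows that almost surely there is no kink at `s = 0` (`IsWholePlaneGFF.ae_notMem_of_ae_line`). Thus
almost surely all geodesics from `z` to `w` have the same `f`-integral, simultaneously for countably
many `f`. It remains to take for `f` the potentials of differences of concentric radial bumps with
rational data, which by the mean value property of the logarithm are constant outside a disc and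
larger inside (`exists_greenPotential_bump`): two different geodesics are separated by a disc which
meets only one of them.
-/

namespace LQG

/-! ### Geodesics of a metric on the plane -/

namespace PlaneMetric

variable {d : PlaneMetric} {z w : ℂ} {L : ℝ} {P : ℝ → ℂ}

lemma dist_nonneg (d : PlaneMetric) (x y : ℂ) : 0 ≤ d.dist x y := by
  have := d.dist_triangle x y x
  rw [d.dist_self, d.dist_comm y x] at this
  linarith

lemma eventually_dist_lt (d : PlaneMetric) (x : ℂ) {ε : ℝ} (hε : 0 < ε) :
    ∀ᶠ y in nhds x, d.dist x y < ε := by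
  have ho : IsOpen {y | d.dist x y < ε} := (d.isOpen_iff _).2 fun y hy =>
    ⟨ε - d.dist x y, sub_pos.2 hy, fun v hv => by
      have := d.dist_triangle x y v
      change d.dist x v < ε
      linarith⟩
  exact ho.mem_nhds (by simpa [d.dist_self] using hε)

lemma continuous_dist (d : PlaneMetric) : Continuous fun p : ℂ × ℂ => d.dist p.1 p.2 := by
  rw [continuous_iff_continuousAt]
  rintro ⟨x, y⟩
  refine Metric.tendsto_nhds.2 fun ε hε => ?_
  rw [nhds_prod_eq]
  filter_upwards [(d.eventually_dist_lt x (half_pos hε)).prod_mk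
    (d.eventually_dist_lt y (half_pos hε))] with p hp
  rw [Real.dist_eq, abs_lt]
  have h₁ := d.dist_triangle x p.1 y
  have h₂ := d.dist_triangle p.1 p.2 y
  have h₃ := d.dist_triangle p.1 x p.2
  have h₄ := d.dist_triangle x y p.2
  rw [d.dist_comm p.2 y] at h₂
  rw [d.dist_comm p.1 x] at h₃
  constructor <;> linarith [hp.1, hp.2]

lemma continuousOn_of_dist_le {S : Set ℝ} (h : ∀ s ∈ S, ∀ t ∈ S, d.dist (P s) (P t) ≤ |t - s|) :
    ContinuousOn P S := by
  intro s hs O hO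
  obtain ⟨U, hU, hUo, hsU⟩ := mem_nhds_iff.1 hO
  obtain ⟨ε, hε, hεU⟩ := (d.isOpen_iff U).1 hUo _ hsU
  have hm : {t : ℝ | |t - s| < ε} ∈ nhds s := Metric.ball_mem_nhds s hε
  change ∀ᶠ t in nhdsWithin s S, P t ∈ O
  filter_upwards [mem_nhdsWithin_of_mem_nhds hm, self_mem_nhdsWithin] with t ht htS
  exact hU (hεU _ ((h s hs t htS).trans_lt ht))

lemma ofReal_dist_le_length {ι : Type*} [LinearOrder ι] (d : PlaneMetric) (P : ι → ℂ) {S : Set ι}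
    {s t : ι} (hs : s ∈ S) (ht : t ∈ S) :
    ENNReal.ofReal (d.dist (P s) (P t)) ≤ d.length P S := by
  have h := @eVariationOn.edist_le ι _ ℂ d.toMetricSpace.toPseudoMetricSpace.toPseudoEMetricSpace
    P S s t hs ht
  rw [@edist_dist ℂ d.toMetricSpace.toPseudoMetricSpace] at h
  exact h

/-- Cutting a path at two times bounds its length below by the length of a polygon. -/
lemma ofReal_dist_add_dist_add_dist_le_length {ι : Type*} [LinearOrder ι] (d : PlaneMetric)
    (P : ι → ℂ) {a s t b : ι} (has : a ≤ s) (hst : s ≤ t) (htb : t ≤ b) :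
    ENNReal.ofReal (d.dist (P a) (P s) + d.dist (P s) (P t) + d.dist (P t) (P b)) ≤
      d.length P univ := by
  have hadd : ∀ {x y v : ι}, x ≤ y → y ≤ v →
      d.length P (Icc x y) + d.length P (Icc y v) = d.length P (Icc x v) := fun hxy hyv => by
    have := @eVariationOn.Icc_add_Icc ι _ ℂ
      d.toMetricSpace.toPseudoMetricSpace.toPseudoEMetricSpace P univ _ _ _ hxy hyv (mem_univ _)
    rw [univ_inter, univ_inter, univ_inter] at this
    exact this
  have h₂ : d.length P (Icc a b) ≤ d.length P univ :=
    @eVariationOn.mono ι _ ℂ d.toMetricSpace.toPseudoMetricSpace.toPseudoEMetricSpace P _ _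
      (subset_univ _)
  refine le_trans ?_ h₂
  rw [ENNReal.ofReal_add (add_nonneg (d.dist_nonneg _ _) (d.dist_nonneg _ _)) (d.dist_nonneg _ _),
    ENNReal.ofReal_add (d.dist_nonneg _ _) (d.dist_nonneg _ _), ← hadd (has.trans hst) htb,
    ← hadd has hst]
  gcongr
  · exact d.ofReal_dist_le_length P (left_mem_Icc.2 has) (right_mem_Icc.2 has)
  · exact d.ofReal_dist_le_length P (left_mem_Icc.2 hst) (right_mem_Icc.2 hst)
  · exact d.ofReal_dist_le_length P (left_mem_Icc.2 htb) (right_mem_Icc.2 htb)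

lemma IsLengthParam.dist_le (h : d.IsLengthParam z w L P) {s t : ℝ} (hs : 0 ≤ s) (hst : s ≤ t)
    (ht : t ≤ L) : d.dist (P s) (P t) ≤ t - s := by
  have h₁ := d.ofReal_dist_le_length P (left_mem_Icc.2 hst) (right_mem_Icc.2 hst)
  rw [h.length_eq s t hs hst ht] at h₁
  exact (ENNReal.ofReal_le_ofReal_iff (by linarith)).1 h₁

lemma IsLengthParam.dist_le_length (h : d.IsLengthParam z w L P) : d.dist z w ≤ L := by
  have := h.dist_le le_rfl h.nonneg le_rfl
  rwa [h.source, h.target, sub_zero] at this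

/-- A `1`-Lipschitz map between points at distance `L` is isometric on `[0, L]`. -/
lemma dist_eq_of_dist_le (h₀ : P 0 = z) (h₁ : P (d.dist z w) = w)
    (h : ∀ s t, 0 ≤ s → s ≤ t → t ≤ d.dist z w → d.dist (P s) (P t) ≤ t - s) {s t : ℝ}
    (hs : 0 ≤ s) (hst : s ≤ t) (ht : t ≤ d.dist z w) : d.dist (P s) (P t) = t - s := by
  have a₁ := h 0 s le_rfl hs (hst.trans ht)
  have a₂ := h s t hs hst ht
  have a₃ := h t _ (hs.trans hst) ht le_rfl
  rw [h₀] at a₁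
  rw [h₁] at a₃
  have b₁ := d.dist_triangle z (P s) w
  have b₂ := d.dist_triangle (P s) (P t) w
  linarith

lemma dist_le_abs_sub (h : ∀ s t, 0 ≤ s → s ≤ t → t ≤ L → d.dist (P s) (P t) ≤ t - s)
    {s t : ℝ} (hs : s ∈ Icc 0 L) (ht : t ∈ Icc 0 L) : d.dist (P s) (P t) ≤ |t - s| := by
  rcases le_total s t with hst | hst
  · rw [abs_of_nonneg (sub_nonneg.2 hst)]
    exact h s t hs.1 hst ht.2
  · rw [abs_sub_comm, abs_of_nonneg (sub_nonneg.2 hst), d.dist_comm]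
    exact h t s ht.1 hst hs.2

lemma length_comp_le (h : ∀ s t, 0 ≤ s → s ≤ t → t ≤ L → d.dist (P s) (P t) ≤ t - s)
    {ι : Type*} [LinearOrder ι] {σ : ι → ℝ} {S : Set ι} (hσ : MonotoneOn σ S)
    (hS : MapsTo σ S (Icc 0 L)) {a b : ι} (ha : a ∈ S) (hb : b ∈ S) (hab : S ⊆ Icc a b) :
    d.length (P ∘ σ) S ≤ ENNReal.ofReal (σ b - σ a) := by
  have hlip : @LipschitzOnWith ℝ ℂ _ d.toMetricSpace.toPseudoMetricSpace.toPseudoEMetricSpace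
      1 P (Icc 0 L) := by
    refine @LipschitzOnWith.of_dist_le_mul ℝ ℂ _ d.toMetricSpace.toPseudoMetricSpace _ _ _
      fun x hx y hy => ?_
    rw [NNReal.coe_one, one_mul, Real.dist_eq, abs_sub_comm]
    exact dist_le_abs_sub h hx hy
  have h₁ := @LipschitzOnWith.comp_eVariationOn_le ι _ ℝ _ ℂ
    d.toMetricSpace.toPseudoMetricSpace.toPseudoEMetricSpace P _ _ hlip σ S hS
  rw [ENNReal.coe_one, one_mul] at h₁
  have h₂ := hσ.eVariationOn_eq ha hb
  rw [inter_eq_left.2 hab] at h₂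
  exact h₁.trans h₂.le

/-- A `1`-Lipschitz map on `[0, d(z, w)]` which joins `z` to `w` is parametrized by length. -/
lemma isLengthParam_of_dist_le (h₀ : P 0 = z) (h₁ : P (d.dist z w) = w)
    (h : ∀ s t, 0 ≤ s → s ≤ t → t ≤ d.dist z w → d.dist (P s) (P t) ≤ t - s) :
    d.IsLengthParam z w (d.dist z w) P where
  nonneg := d.dist_nonneg z w
  source := h₀
  target := h₁
  continuousOn := continuousOn_of_dist_le fun _ hs _ ht => dist_le_abs_sub h hs ht
  length_eq s t hs hst ht := by
    apply le_antisymm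
    · exact length_comp_le (σ := id) h monotoneOn_id
        (fun x hx => ⟨hs.trans hx.1, hx.2.trans ht⟩) (left_mem_Icc.2 hst) (right_mem_Icc.2 hst)
        subset_rfl
    · rw [← dist_eq_of_dist_le h₀ h₁ h hs hst ht]
      exact d.ofReal_dist_le_length P (left_mem_Icc.2 hst) (right_mem_Icc.2 hst)

/-- Distances are infima of the lengths of paths parametrized by length. -/
def HasApproxGeodesics (d : PlaneMetric) : Prop :=
  ∀ x y : ℂ, ∀ ε > 0, ∃ (L : ℝ) (P : ℝ → ℂ), d.IsLengthParam x y L P ∧ L < d.dist x y + ε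

/-- The balls of `d` around `z` are bounded for the Euclidean metric. -/
def HasBoundedBalls (d : PlaneMetric) (z : ℂ) : Prop :=
  ∀ K : ℝ, ∃ r : ℝ, ∀ x : ℂ, d.dist z x < K → x ∈ Metric.closedBall z r

/-- If circles around `z` have arbitrarily large `d`-distance from `z`, then the `d`-balls around
`z` are bounded: a path which leaves the disc crosses the circle. -/
lemma hasBoundedBalls_of_sphere (ha : d.HasApproxGeodesics)
    (h : ∀ K : ℝ, ∃ r > 0, ∀ x ∈ Metric.sphere z r, K ≤ d.dist z x) : d.HasBoundedBalls z := by
  intro K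
  obtain ⟨r, hr, hK⟩ := h K
  refine ⟨r, fun x hx => ?_⟩
  by_contra hxr
  rw [Metric.mem_closedBall, not_le] at hxr
  obtain ⟨L, P, hP, hL⟩ := ha z x (K - d.dist z x) (by linarith)
  have hc : ContinuousOn (fun t => Dist.dist (P t) z) (Icc 0 L) :=
    (continuous_id.dist continuous_const).comp_continuousOn hP.continuousOn
  have := intermediate_value_Icc hP.nonneg hc
  simp only [hP.source, hP.target, _root_.dist_self] at this
  obtain ⟨t, ht, hrt⟩ := this ⟨hr.le, hxr.le⟩
  have h₁ := hK (P t) hrt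
  have h₂ := hP.dist_le le_rfl ht.1 ht.2
  rw [hP.source] at h₂
  linarith [ht.2]

/-- Existence of geodesics when balls are relatively compact. Almost minimal paths, parametrized by
length, are `1`-Lipschitz maps on `[0, d(x, y)]`; a cluster point for pointwise convergence
is a `1`-Lipschitz map which joins `x` to `y`. -/
lemma exists_isLengthParam_dist (ha : d.HasApproxGeodesics) (hb : d.HasBoundedBalls z) (x y : ℂ) :
    ∃ P : ℝ → ℂ, d.IsLengthParam x y (d.dist x y) P := by
  set L := d.dist x y with hL
  have hL0 : 0 ≤ L := d.dist_nonneg x y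
  choose M R hR hM using fun n : ℕ => ha x y (1 / ((n : ℝ) + 1)) (by positivity)
  have hLM : ∀ n, L ≤ M n := fun n => (hR n).dist_le_length
  obtain ⟨r, hr⟩ := hb (d.dist z x + L + 1)
  let clamp : ℝ → ℝ := fun s => max 0 (min s L)
  have hclamp : ∀ s, 0 ≤ s → s ≤ L → clamp s = s := fun s h₀ h₁ => by
    simp [clamp, h₀, h₁]
  let F : ℕ → ℝ → ℂ := fun n s => R n (clamp s)
  have hcl : ∀ s, 0 ≤ clamp s ∧ clamp s ≤ L := fun s =>
    ⟨le_max_left _ _, max_le hL0 (min_le_right _ _)⟩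
  have hF : ∀ n, F n ∈ Set.pi univ fun _ : ℝ => Metric.closedBall z r := by
    intro n s _
    apply hr
    have h₁ := (hR n).dist_le le_rfl (hcl s).1 ((hcl s).2.trans (hLM n))
    rw [(hR n).source] at h₁
    have h₂ := d.dist_triangle z x (F n s)
    have h₃ := (hcl s).2
    change d.dist z (F n s) < _
    change d.dist x (F n s) ≤ _ at h₁
    linarith
  have hcomp : IsCompact (Set.pi univ fun _ : ℝ => Metric.closedBall z r) :=
    isCompact_univ_pi fun _ => isCompact_closedBall z r
  obtain ⟨Q, -, hQ⟩ := hcomp.exists_mapClusterPt (f := Filter.atTop) (u := F)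
    (Filter.Eventually.of_forall hF |> Filter.tendsto_principal.2)
  -- closed conditions that hold eventually along the sequence hold at a cluster point
  have key : ∀ C : Set (ℝ → ℂ), IsClosed C → (∀ᶠ n in Filter.atTop, F n ∈ C) → Q ∈ C := by
    intro C hC hev
    by_contra hQC
    exact (hQ.frequently (hC.isOpen_compl.mem_nhds hQC)) (hev.mono fun n hn hn' => hn' hn)
  have hd : ∀ s t : ℝ, Continuous fun G : ℝ → ℂ => d.dist (G s) (G t) := fun s t =>
    d.continuous_dist.comp (f := fun G : ℝ → ℂ => (G s, G t))
      ((continuous_apply s).prodMk (continuous_apply t))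
  have hdy : Continuous fun G : ℝ → ℂ => d.dist (G L) y :=
    d.continuous_dist.comp (f := fun G : ℝ → ℂ => (G L, y))
      ((continuous_apply L).prodMk continuous_const)
  refine ⟨Q, isLengthParam_of_dist_le ?_ ?_ ?_⟩
  · refine key {G | G 0 = x} (isClosed_eq (continuous_apply 0) continuous_const)
      (Filter.Eventually.of_forall fun n => ?_)
    change R n (clamp 0) = x
    rw [hclamp 0 le_rfl hL0, (hR n).source]
  · apply d.eq_of_dist_eq_zero
    apply le_antisymm _ (d.dist_nonneg _ _)
    apply le_of_forall_pos_le_add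
    intro ε hε
    refine key {G | d.dist (G L) y ≤ 0 + ε} (isClosed_le hdy continuous_const) ?_
    have := (tendsto_one_div_add_atTop_nhds_zero_nat (𝕜 := ℝ)).eventually (gt_mem_nhds hε)
    filter_upwards [this] with n hn
    change d.dist (R n (clamp L)) y ≤ 0 + ε
    rw [hclamp L hL0 le_rfl]
    have h₁ := (hR n).dist_le hL0 (hLM n) le_rfl
    rw [(hR n).target] at h₁
    linarith [hM n]
  · intro s t hs hst ht
    refine key {G | d.dist (G s) (G t) ≤ t - s} (isClosed_le (hd s t) continuous_const)
      (Filter.Eventually.of_forall fun n => ?_)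
    change d.dist (R n (clamp s)) (R n (clamp t)) ≤ t - s
    rw [hclamp s hs (hst.trans ht), hclamp t (hs.trans hst) ht]
    exact (hR n).dist_le hs hst (ht.trans (hLM n))

/-- A path parametrized by length, as a path on the unit interval. -/
lemma IsLengthParam.exists_path (h : d.IsLengthParam z w L P) :
    ∃ γ : Path z w, ∀ t : unitInterval, γ t = P (L * t) := by
  have hm : ∀ t : unitInterval, L * (t : ℝ) ∈ Icc 0 L := fun t =>
    ⟨mul_nonneg h.nonneg t.2.1, mul_le_of_le_one_right h.nonneg t.2.2⟩
  exact ⟨{ toFun := fun t => P (L * t)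
           continuous_toFun := h.continuousOn.comp_continuous (by fun_prop) hm
           source' := by simp [h.source]
           target' := by simp [h.target] }, fun t => rfl⟩

lemma pathLength_le_of_comp {γ : Path z w} {σ : unitInterval → ℝ}
    (h : d.IsLengthParam z w L P) (hσ : Monotone σ) (h₀ : σ 0 = 0) (h₁ : σ 1 = L)
    (hγ : ∀ t, γ t = P (σ t)) : d.pathLength γ ≤ ENNReal.ofReal L := by
  have e : (γ : unitInterval → ℂ) = P ∘ σ := funext hγ
  have := length_comp_le (d := d) (P := P) (L := L) (fun s t hs hst ht => h.dist_le hs hst ht)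
    (S := univ) (hσ.monotoneOn _)
    (fun t _ => ⟨h₀ ▸ hσ t.2.1, h₁ ▸ hσ t.2.2⟩) (mem_univ 0) (mem_univ 1)
    (fun t _ => ⟨t.2.1, t.2.2⟩)
  rw [h₀, h₁, sub_zero] at this
  rw [pathLength, e]
  exact this

lemma ofReal_dist_le_pathLength (γ : Path z w) : ENNReal.ofReal (d.dist z w) ≤ d.pathLength γ := by
  have := d.ofReal_dist_le_length γ (mem_univ 0) (mem_univ 1)
  rwa [γ.source, γ.target] at this

/-- Geodesics are unique as soon as any two geodesics parametrized by length agree: the time at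
which a geodesic passes through a point `x` is `d(z, x)`. -/
lemma hasUniqueGeodesic_of_eqOn (ha : d.HasApproxGeodesics) (hb : d.HasBoundedBalls z)
    (hu : ∀ P₁ P₂ : ℝ → ℂ, d.IsLengthParam z w (d.dist z w) P₁ →
      d.IsLengthParam z w (d.dist z w) P₂ → EqOn P₁ P₂ (Icc 0 (d.dist z w))) :
    d.HasUniqueGeodesic z w := by
  obtain ⟨P, hP⟩ := exists_isLengthParam_dist ha hb z w
  have hdist : ∀ s, 0 ≤ s → s ≤ d.dist z w → d.dist z (P s) = s := fun s hs hs' => by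
    have := dist_eq_of_dist_le hP.source hP.target (fun _ _ => hP.dist_le) le_rfl hs hs'
    rwa [hP.source, sub_zero] at this
  obtain ⟨γ₀, hγ₀⟩ := hP.exists_path
  have hγ₀L : d.pathLength γ₀ ≤ ENNReal.ofReal (d.dist z w) :=
    pathLength_le_of_comp hP
      (fun s t hst => mul_le_mul_of_nonneg_left (Subtype.coe_le_coe.2 hst) hP.nonneg)
      (by simp) (by simp) hγ₀
  refine ⟨d.dist z w, P, hP, fun γ => ⟨fun hγ => ?_, ?_⟩⟩
  · have hlen : d.pathLength γ ≤ ENNReal.ofReal (d.dist z w) := (hγ.2 γ₀).trans hγ₀L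
    have h3 : ∀ s t : unitInterval, s ≤ t →
        d.dist z (γ s) + d.dist (γ s) (γ t) + d.dist (γ t) w ≤ d.dist z w := by
      intro s t hst
      have h₁ := (d.ofReal_dist_add_dist_add_dist_le_length γ (a := 0) (b := 1)
        s.2.1 hst t.2.2).trans hlen
      rw [γ.target, γ.source] at h₁
      exact (ENNReal.ofReal_le_ofReal_iff (d.dist_nonneg _ _)).1 h₁
    refine ⟨fun t => d.dist z (γ t),
      d.continuous_dist.comp (continuous_const.prodMk γ.continuous), fun s t hst => ?_,
      by simp [d.dist_self], by simp, fun t => ?_⟩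
    · have h₁ := h3 s t hst
      have h₂ := d.dist_triangle (γ s) (γ t) w
      have h₄ := d.dist_triangle z (γ s) w
      have h₅ := d.dist_triangle z (γ t) w
      have h₆ := d.dist_nonneg (γ s) (γ t)
      dsimp only
      linarith
    · -- concatenate geodesics from `z` to `x` and from `x` to `w`
      set x := γ t
      have hx : d.dist z x + d.dist x w = d.dist z w := by
        have h₁ := h3 t t le_rfl
        rw [d.dist_self, add_zero] at h₁
        exact le_antisymm h₁ (d.dist_triangle _ _ _)
      obtain ⟨P₁, h₁⟩ := exists_isLengthParam_dist ha hb z x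
      obtain ⟨P₂, h₂⟩ := exists_isLengthParam_dist ha hb x w
      have hzx := d.dist_nonneg z x
      have hxw := d.dist_nonneg x w
      let R : ℝ → ℂ := fun s => if s ≤ d.dist z x then P₁ s else P₂ (s - d.dist z x)
      have hRx : R (d.dist z x) = x := by simp [R, h₁.target]
      have hR2 : ∀ s, d.dist z x ≤ s → R s = P₂ (s - d.dist z x) := by
        intro s hs
        rcases hs.eq_or_lt with hs | hs
        · rw [← hs, hRx, sub_self, h₂.source]
        · simp [R, not_le.2 hs]
      have hR1 : ∀ s, s ≤ d.dist z x → R s = P₁ s := fun s hs => by simp [R, hs]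
      have hR : d.IsLengthParam z w (d.dist z w) R := by
        refine isLengthParam_of_dist_le ?_ ?_ ?_
        · rw [hR1 0 hzx, h₁.source]
        · rw [hR2 _ (by linarith), ← hx, add_sub_cancel_left, h₂.target]
        · have A : ∀ s t, 0 ≤ s → s ≤ t → t ≤ d.dist z x → d.dist (R s) (R t) ≤ t - s := by
            intro s t hs hst ht
            rw [hR1 s (hst.trans ht), hR1 t ht]
            exact h₁.dist_le hs hst ht
          have B : ∀ s t, d.dist z x ≤ s → s ≤ t → t ≤ d.dist z w →
              d.dist (R s) (R t) ≤ t - s := by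
            intro s t hs hst ht
            rw [hR2 s hs, hR2 t (hs.trans hst)]
            have := h₂.dist_le (s := s - d.dist z x) (t := t - d.dist z x) (by linarith)
              (by linarith) (by linarith)
            linarith
          intro s t hs hst ht
          rcases le_total t (d.dist z x) with hc | hc
          · exact A s t hs hst hc
          rcases le_total (d.dist z x) s with hc' | hc'
          · exact B s t hc' hst ht
          have a₁ := A s _ hs hc' le_rfl
          have a₂ := B _ t le_rfl hc ht
          have := d.dist_triangle (R s) (R (d.dist z x)) (R t)
          linarith
      have := hu R P hR hP ⟨hzx, by linarith⟩
      rwa [hRx] at this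
  · rintro ⟨σ, -, hσ, h₀, h₁, hγ⟩
    have := pathLength_le_of_comp hP hσ h₀ h₁ hγ
    exact ⟨(this.trans_lt ENNReal.ofReal_lt_top).ne,
      fun γ' => this.trans (ofReal_dist_le_pathLength γ')⟩

end PlaneMetric

/-! ### Variation of geodesic lengths under Weyl scaling -/

namespace PlaneMetric

variable {d : PlaneMetric} {z w : ℂ} {L ξ : ℝ} {P : ℝ → ℂ}

lemma weyl_le (hP : d.IsLengthParam z w L P) (f : C(ℂ, ℝ)) :
    d.weyl ξ f z w ≤ ∫⁻ t in Icc 0 L, ENNReal.ofReal (Real.exp (ξ * f (P t))) :=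
  iInf_le_of_le L (iInf_le_of_le P (iInf_le _ hP))

lemma weyl_le_mul (d : PlaneMetric) (hξ : 0 ≤ ξ) {f g : C(ℂ, ℝ)} {c : ℝ} (h : ∀ x, f x ≤ g x + c)
    (z w : ℂ) : d.weyl ξ f z w ≤ ENNReal.ofReal (Real.exp (ξ * c)) * d.weyl ξ g z w := by
  have h0 : ENNReal.ofReal (Real.exp (ξ * c)) ≠ 0 := by simp [Real.exp_pos]
  conv_rhs => rw [weyl]
  rw [ENNReal.mul_iInf_of_ne h0 ENNReal.ofReal_ne_top]
  refine le_iInf fun L => ?_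
  rw [ENNReal.mul_iInf_of_ne h0 ENNReal.ofReal_ne_top]
  refine le_iInf fun P => ?_
  rw [ENNReal.mul_iInf_of_ne h0 ENNReal.ofReal_ne_top]
  refine le_iInf fun hP => (weyl_le hP f).trans ?_
  rw [← lintegral_const_mul' _ _ ENNReal.ofReal_ne_top]
  refine lintegral_mono fun t => ?_
  rw [← ENNReal.ofReal_mul (Real.exp_pos _).le, ← Real.exp_add]
  refine ENNReal.ofReal_le_ofReal (Real.exp_le_exp.2 ?_)
  nlinarith [h (P t)]

lemma weyl_const (d : PlaneMetric) (hξ : 0 ≤ ξ) (c : ℝ) (z w : ℂ) :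
    d.weyl ξ (ContinuousMap.const ℂ c) z w =
      ENNReal.ofReal (Real.exp (ξ * c)) * d.weyl ξ 0 z w := by
  refine le_antisymm (d.weyl_le_mul hξ (by simp) z w) ?_
  calc ENNReal.ofReal (Real.exp (ξ * c)) * d.weyl ξ 0 z w
      ≤ ENNReal.ofReal (Real.exp (ξ * c)) * (ENNReal.ofReal (Real.exp (ξ * -c)) *
          d.weyl ξ (ContinuousMap.const ℂ c) z w) := by
        gcongr
        exact d.weyl_le_mul hξ (by simp) z w
    _ = d.weyl ξ (ContinuousMap.const ℂ c) z w := by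
        rw [← mul_assoc, ← ENNReal.ofReal_mul (Real.exp_pos _).le, ← Real.exp_add]
        simp

lemma hasApproxGeodesics_of_weyl (h : ∀ x y, d.weyl ξ 0 x y = ENNReal.ofReal (d.dist x y)) :
    d.HasApproxGeodesics := by
  intro x y ε hε
  have hlt : d.weyl ξ 0 x y < ENNReal.ofReal (d.dist x y + ε) := by
    rw [h]
    have := d.dist_nonneg x y
    exact (ENNReal.ofReal_lt_ofReal_iff (by linarith)).2 (by linarith)
  simp only [weyl, iInf_lt_iff] at hlt
  obtain ⟨L, P, hP, hL⟩ := hlt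
  refine ⟨L, P, hP, ?_⟩
  simp only [ContinuousMap.zero_apply, mul_zero, Real.exp_zero, ENNReal.ofReal_one, lintegral_const,
    Measure.restrict_apply, MeasurableSet.univ, univ_inter, Real.volume_Icc, sub_zero,
    one_mul] at hL
  have hpos : 0 < d.dist x y + ε := add_pos_of_nonneg_of_pos (d.dist_nonneg x y) hε
  exact (ENNReal.ofReal_lt_ofReal_iff hpos).1 hL

lemma IsLengthParam.integrableOn_comp (hP : d.IsLengthParam z w L P) {f : ℂ → ℝ}
    (hf : Continuous f) : IntegrableOn (fun t => f (P t)) (Icc 0 L) :=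
  (hf.comp_continuousOn hP.continuousOn).integrableOn_compact isCompact_Icc

/-- Second order upper bound for the length of a fixed path in the metrics `e^{ξ s f} · d`. -/
lemma IsLengthParam.weyl_smul_le (hP : d.IsLengthParam z w L P) {f : C(ℂ, ℝ)} {M : ℝ}
    (hM : ∀ x, |f x| ≤ M) {s : ℝ} (hs : |ξ * s| * M ≤ 1) :
    d.weyl ξ (s • f) z w ≤ ENNReal.ofReal
      (L + ξ * s * (∫ t in Icc 0 L, f (P t)) + (|ξ * s| * M) ^ 2 * L) := by
  refine (weyl_le hP _).trans ?_
  have hcont : Continuous fun x => Real.exp (ξ * (s • f) x) := by fun_prop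
  rw [← ofReal_integral_eq_lintegral_ofReal (hP.integrableOn_comp hcont)
    (Filter.Eventually.of_forall fun _ => (Real.exp_pos _).le)]
  refine ENNReal.ofReal_le_ofReal ?_
  have h1 : IntegrableOn (fun _ : ℝ => (1 : ℝ)) (Icc 0 L) := by simp
  have h2 : IntegrableOn (fun t => ξ * s * f (P t)) (Icc 0 L) :=
    (hP.integrableOn_comp f.continuous).const_mul _
  have h3 : IntegrableOn (fun _ : ℝ => (|ξ * s| * M) ^ 2) (Icc 0 L) :=
    continuousOn_const.integrableOn_compact isCompact_Icc
  have h12 : IntegrableOn (fun t => 1 + ξ * s * f (P t)) (Icc 0 L) := h1.add h2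
  have e : ∫ t in Icc 0 L, (1 + ξ * s * f (P t) + (|ξ * s| * M) ^ 2) =
      L + ξ * s * (∫ t in Icc 0 L, f (P t)) + (|ξ * s| * M) ^ 2 * L := by
    rw [integral_add h12 h3, integral_add h1 h2, integral_const_mul]
    simp [hP.nonneg, mul_comm]
  rw [← e]
  refine setIntegral_mono (hP.integrableOn_comp hcont) (h12.add h3) fun t => ?_
  have hx : |ξ * s * f (P t)| ≤ |ξ * s| * M := by
    rw [abs_mul]
    exact mul_le_mul_of_nonneg_left (hM _) (abs_nonneg _)
  have := (abs_le.1 (Real.abs_exp_sub_one_sub_id_le (hx.trans hs))).2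
  have h4 : (ξ * s * f (P t)) ^ 2 ≤ (|ξ * s| * M) ^ 2 := by
    rw [← sq_abs]
    gcongr
  have h5 : ξ * (s • f) (P t) = ξ * s * f (P t) := by simp [mul_assoc]
  simp only [h5]
  linarith

end PlaneMetric

/-- The graph of `g` has a concave kink at `s`, which shows in the second differences with steps
`1 / (k + 1)`: they are at most a negative multiple of the step. Only countably many values of `g`
enter, which makes this a measurable condition on a random function. -/
def HasConcaveKink (g : ℝ → ℝ) (s : ℝ) : Prop :=
  ∃ n m : ℕ, ∀ k : ℕ, m ≤ k →
    ((k : ℝ) + 1) * (g (s + 1 / ((k : ℝ) + 1)) + g (s - 1 / ((k : ℝ) + 1)) - 2 * g s) ≤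
      -(1 / ((n : ℝ) + 1))

lemma _root_.DifferentiableAt.not_hasConcaveKink {g : ℝ → ℝ} {s : ℝ}
    (hg : DifferentiableAt ℝ g s) : ¬ HasConcaveKink g s := by
  rintro ⟨n, m, h⟩
  have hlim : ∀ σ : ℝ, σ ≠ 0 → Filter.Tendsto
      (fun k : ℕ => ((k : ℝ) + 1) * (g (s + σ * (1 / ((k : ℝ) + 1))) - g s)) Filter.atTop
      (nhds (σ * deriv g s)) := by
    intro σ hσ
    have h1 := hasDerivAt_iff_tendsto_slope_zero.1 hg.hasDerivAt
    have h2 : Filter.Tendsto (fun k : ℕ => σ * (1 / ((k : ℝ) + 1))) Filter.atTop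
        (nhdsWithin 0 {0}ᶜ) := by
      refine tendsto_nhdsWithin_iff.2 ⟨?_, Filter.Eventually.of_forall fun k => ?_⟩
      · simpa using (tendsto_one_div_add_atTop_nhds_zero_nat (𝕜 := ℝ)).const_mul σ
      · exact mul_ne_zero hσ (by positivity)
    have h3 := (h1.comp h2).const_mul σ
    refine h3.congr fun k => ?_
    have : (k : ℝ) + 1 ≠ 0 := by positivity
    simp only [Function.comp_apply, smul_eq_mul]
    field_simp
  have h1 := (hlim 1 one_ne_zero).add (hlim (-1) (by norm_num))
  have h2 : 1 * deriv g s + -1 * deriv g s = 0 := by ring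
  rw [h2] at h1
  have h3 : (0 : ℝ) ≤ -(1 / ((n : ℝ) + 1)) := by
    refine le_of_tendsto h1 ?_
    filter_upwards [Filter.eventually_ge_atTop m] with k hk
    have := h k hk
    have e : ∀ x : ℝ, s + -1 * x = s - x := fun x => by ring
    rw [e, one_mul]
    linarith
  have h4 : (0 : ℝ) < 1 / ((n : ℝ) + 1) := by positivity
  linarith

/-- A positive function whose logarithm is Lipschitz has almost no concave kinks. -/
lemma ae_not_hasConcaveKink {g : ℝ → ℝ} (hpos : ∀ s, 0 < g s) {C : ℝ}
    (hC : ∀ s t, g s ≤ Real.exp (C * |s - t|) * g t) : ∀ᵐ s, ¬ HasConcaveKink g s := by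
  have hC0 : 0 ≤ C := by
    have := hC 1 0
    have h2 := hC 0 1
    simp only [sub_zero, abs_one, mul_one, zero_sub, abs_neg] at this h2
    by_contra hneg
    have h1 : Real.exp C < 1 := Real.exp_zero ▸ Real.exp_lt_exp.2 (not_le.1 hneg)
    nlinarith [hpos 0, hpos 1]
  have hlip : LipschitzWith C.toNNReal fun s => Real.log (g s) := by
    refine LipschitzWith.of_le_add_mul _ fun s t => ?_
    rw [Real.coe_toNNReal _ hC0, Real.dist_eq]
    have := Real.log_le_log (hpos s) (hC s t)
    rw [Real.log_mul (Real.exp_pos _).ne' (hpos t).ne', Real.log_exp] at this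
    linarith
  filter_upwards [hlip.ae_differentiableAt_real] with s hs
  have : DifferentiableAt ℝ g s := by
    have h1 := hs.exp
    simpa only [Real.exp_log (hpos _)] using h1
  exact this.not_hasConcaveKink

namespace PlaneMetric

/-- If two geodesics have different `f`-integrals, the distance between their endpoints in
`e^{ξ s f} · d` has a concave kink at `s = 0`: it is the minimum of at least two functions with
different derivatives. -/
lemma hasConcaveKink_of_integral_lt {d : PlaneMetric} {z w : ℂ} {ξ : ℝ} (hξ : 0 < ξ)
    {f : C(ℂ, ℝ)} {M : ℝ} (hM : ∀ x, |f x| ≤ M) {g : ℝ → ℝ} (hg0 : g 0 = d.dist z w)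
    (hg : ∀ s, d.weyl ξ (s • f) z w = ENNReal.ofReal (g s)) {P₁ P₂ : ℝ → ℂ}
    (h₁ : d.IsLengthParam z w (d.dist z w) P₁) (h₂ : d.IsLengthParam z w (d.dist z w) P₂)
    (hlt : ∫ t in Icc 0 (d.dist z w), f (P₁ t) < ∫ t in Icc 0 (d.dist z w), f (P₂ t)) :
    HasConcaveKink g 0 := by
  set L := d.dist z w with hL
  set I₁ := ∫ t in Icc 0 L, f (P₁ t)
  set I₂ := ∫ t in Icc 0 L, f (P₂ t)
  have hL0 : 0 ≤ L := d.dist_nonneg z w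
  have hM0 : 0 ≤ M := (abs_nonneg _).trans (hM 0)
  set a := ξ * (I₂ - I₁)
  have ha : 0 < a := mul_pos hξ (sub_pos.2 hlt)
  set C := 2 * (ξ * M) ^ 2 * L
  have hC : 0 ≤ C := by positivity
  have hL2 : 0 < L := by
    by_contra h
    have : L = 0 := le_antisymm (not_lt.1 h) hL0
    simp [I₁, I₂, this] at hlt
  obtain ⟨n, hn⟩ := exists_nat_gt (2 / a)
  have hξM : 0 ≤ ξ * M := by positivity
  -- the error terms of the expansion vanish as the step tends to zero
  have hev : ∀ᶠ k : ℕ in Filter.atTop, ∀ b ∈ ({ξ * M, 2 * C / a} : Set ℝ),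
      1 / ((k : ℝ) + 1) * b ≤ 1 ∧ |ξ * (1 / ((k : ℝ) + 1)) * I₁| + |ξ * (1 / ((k : ℝ) + 1)) * I₂|
        ≤ L := by
    have t := tendsto_one_div_add_atTop_nhds_zero_nat (𝕜 := ℝ)
    have t1 : ∀ b : ℝ, ∀ᶠ k : ℕ in Filter.atTop, 1 / ((k : ℝ) + 1) * b ≤ 1 := fun b => by
      have := t.mul_const b
      rw [zero_mul] at this
      exact (this.eventually (gt_mem_nhds one_pos)).mono fun _ h => h.le
    have t2 : ∀ᶠ k : ℕ in Filter.atTop,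
        |ξ * (1 / ((k : ℝ) + 1)) * I₁| + |ξ * (1 / ((k : ℝ) + 1)) * I₂| ≤ L := by
      have := (((t.const_mul ξ).mul_const I₁).abs).add (((t.const_mul ξ).mul_const I₂).abs)
      simp only [mul_zero, zero_mul, abs_zero, add_zero] at this
      exact (this.eventually (gt_mem_nhds hL2)).mono fun _ h => h.le
    filter_upwards [t1 (ξ * M), t1 (2 * C / a), t2] with k h1 h2 h3 b hb
    rcases hb with rfl | rfl
    · exact ⟨h1, h3⟩
    · exact ⟨h2, h3⟩
  obtain ⟨m, hm⟩ := Filter.eventually_atTop.1 hev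
  refine ⟨n, m, fun k hk => ?_⟩
  set s := 1 / ((k : ℝ) + 1) with hs
  have hs0 : 0 < s := by positivity
  obtain ⟨hk1, hk2⟩ := hm k hk _ (mem_insert _ _)
  obtain ⟨hk3, -⟩ := hm k hk _ (mem_insert_of_mem _ rfl)
  have habs : |ξ * s| = ξ * s := abs_of_pos (mul_pos hξ hs0)
  have b₁ := h₁.weyl_smul_le (ξ := ξ) hM (s := s) (by rw [habs]; linarith)
  have b₂ := h₂.weyl_smul_le (ξ := ξ) hM (s := -s)
    (by rw [mul_neg, abs_neg, habs]; linarith)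
  rw [hg, habs] at b₁
  rw [hg, mul_neg, abs_neg, habs] at b₂
  have hsq : 0 ≤ (ξ * s * M) ^ 2 * L := by positivity
  have c₁ := (ENNReal.ofReal_le_ofReal_iff (by
    linarith [neg_abs_le (ξ * s * I₁), abs_nonneg (ξ * s * I₂)])).1 b₁
  have c₂ := (ENNReal.ofReal_le_ofReal_iff (by
    linarith [le_abs_self (ξ * s * I₂), abs_nonneg (ξ * s * I₁)])).1 b₂
  rw [zero_add, zero_sub, hg0]
  have hk0 : ((k : ℝ) + 1) * s = 1 := by
    rw [hs]; field_simp
  have hCs : s * C ≤ a / 2 := by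
    have : s * (2 * C / a) * a ≤ 1 * a := by gcongr
    rw [mul_assoc, div_mul_cancel₀ _ ha.ne'] at this
    linarith
  have hsum : g s + g (-s) - 2 * L ≤ s * (-(a / 2)) := by
    have e : 2 * ((ξ * s * M) ^ 2 * L) = s * (s * C) := by simp only [C]; ring
    have e2 : ξ * s * I₁ - ξ * s * I₂ = -(s * a) := by simp only [a]; ring
    have := mul_le_mul_of_nonneg_left hCs hs0.le
    linarith
  calc ((k : ℝ) + 1) * (g s + g (-s) - 2 * L) ≤ ((k : ℝ) + 1) * (s * (-(a / 2))) := by gcongr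
    _ = -(a / 2) := by rw [← mul_assoc, hk0, one_mul]
    _ ≤ -(1 / ((n : ℝ) + 1)) := by
      have : 1 / ((n : ℝ) + 1) ≤ a / 2 := by
        rw [div_le_div_iff₀ (by positivity) two_pos, one_mul]
        have := (div_lt_iff₀ ha).1 hn
        nlinarith
      linarith

end PlaneMetric

/-! ### Logarithmic potentials -/

lemma locallyIntegrable_log_norm : LocallyIntegrable fun v : ℂ => Real.log ‖v‖ := by
  rw [locallyIntegrable_iff]
  intro K hK
  obtain ⟨R, hR⟩ := hK.isBounded.subset_ball (0 : ℂ)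
  refine IntegrableOn.mono_set ?_ hR
  rw [integrableOn_fun_norm_addHaar, Complex.finrank_real_complex]
  simp only [Nat.add_one_sub_one, pow_one, smul_eq_mul]
  exact (Real.continuous_mul_log.continuousOn.integrableOn_compact isCompact_Icc).mono_set
    Ioo_subset_Icc_self

/-- The logarithmic potential `x ↦ ∫ φ(v) log|x - v| dv` (without sign). -/
noncomputable def logPotential (φ : ℂ → ℝ) (x : ℂ) : ℝ := ∫ v, φ v * Real.log ‖x - v‖

section
variable {φ : ℂ → ℝ}

lemma continuous_logPotential (hφ : Continuous φ) (hc : HasCompactSupport φ) :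
    Continuous (logPotential φ) :=
  hc.continuous_convolution_left (ContinuousLinearMap.mul ℝ ℝ) hφ locallyIntegrable_log_norm

lemma integrable_mul_log_norm_sub (hφ : Continuous φ) (hc : HasCompactSupport φ) (x : ℂ) :
    Integrable fun v => φ v * Real.log ‖x - v‖ :=
  hc.convolutionExists_left (ContinuousLinearMap.mul ℝ ℝ) hφ locallyIntegrable_log_norm x

/-- By the mean value property of the logarithm on circles, the potential of a radial density
is obtained by replacing `log|x - v|` with `log max(|x|, |v|)`. -/
lemma logPotential_radial (hφ : Continuous φ) (hc : HasCompactSupport φ)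
    (hrad : ∀ c : Circle, ∀ v, φ (c * v) = φ v) (x : ℂ) :
    logPotential φ x = ∫ v, φ v * Real.log (max ‖x‖ ‖v‖) := by
  rcases eq_or_ne x 0 with rfl | hx
  · simp [logPotential]
  set R := ‖x‖ with hR
  have hR0 : 0 < R := norm_pos_iff.2 hx
  have hinv : ∀ c : Circle, ∀ y, logPotential φ (c * y) = logPotential φ y := by
    intro c y
    have := (rotation c).measurePreserving.integral_comp
      (rotation c).toHomeomorph.measurableEmbedding fun v => φ v * Real.log ‖c * y - v‖
    rw [logPotential, ← this]
    refine integral_congr_ae (Filter.Eventually.of_forall fun v => ?_)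
    simp only [rotation_apply, hrad, ← mul_sub, norm_mul, Circle.norm_coe, one_mul]
  have hcirc : ∀ θ : ℝ, logPotential φ (circleMap 0 R θ) = logPotential φ x := by
    intro θ
    have h1 : circleMap 0 R θ = (Circle.exp (θ - x.arg) : ℂ) * x := by
      have h2 : (Circle.exp (θ - x.arg) : ℂ) * (R * Complex.exp (x.arg * Complex.I)) =
          R * Complex.exp (θ * Complex.I) := by
        rw [Circle.coe_exp, mul_left_comm, ← Complex.exp_add]
        congr 2
        push_cast
        ring
      rw [hR, Complex.norm_mul_exp_arg_mul_I] at h2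
      rw [circleMap, zero_add, h2]
    rw [h1, hinv]
  have hmeas : Measurable fun p : ℝ × ℂ => φ p.2 * Real.log ‖circleMap 0 R p.1 - p.2‖ := by
    have h2 : Measurable fun p : ℝ × ℂ => circleMap 0 R p.1 - p.2 :=
      ((continuous_circleMap 0 R).measurable.comp measurable_fst).sub measurable_snd
    exact (hφ.measurable.comp measurable_snd).mul (Real.measurable_log.comp h2.norm)
  have hint : Integrable (fun p : ℝ × ℂ => φ p.2 * Real.log ‖circleMap 0 R p.1 - p.2‖)
      ((volume.restrict (Ioc 0 (2 * Real.pi))).prod volume) := by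
    rw [integrable_prod_iff hmeas.aestronglyMeasurable]
    refine ⟨Filter.Eventually.of_forall fun θ =>
      integrable_mul_log_norm_sub hφ hc (circleMap 0 R θ), ?_⟩
    have hcont : Continuous fun y : ℂ => ∫ v, ‖φ v‖ * ‖Real.log ‖y - v‖‖ :=
      hc.norm.continuous_convolution_left (ContinuousLinearMap.mul ℝ ℝ) hφ.norm
        fun x => (locallyIntegrable_log_norm x).norm
    have := (hcont.comp (continuous_circleMap 0 R)).integrableOn_Ioc (μ := volume) (a := 0)
      (b := 2 * Real.pi)
    refine this.congr (Filter.Eventually.of_forall fun θ => ?_)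
    change ∫ v, ‖φ v‖ * ‖Real.log ‖circleMap 0 R θ - v‖‖ = _
    simp only [norm_mul]
  have hπ : (0 : ℝ) < 2 * Real.pi := Real.two_pi_pos
  have hswap := integral_integral_swap
    (f := fun θ v => φ v * Real.log ‖circleMap 0 R θ - v‖) hint
  have hleft : ∫ θ in Ioc 0 (2 * Real.pi), ∫ v, φ v * Real.log ‖circleMap 0 R θ - v‖ =
      2 * Real.pi * logPotential φ x := by
    calc _ = ∫ θ in Ioc 0 (2 * Real.pi), logPotential φ x :=
          integral_congr_ae (Filter.Eventually.of_forall hcirc)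
      _ = _ := by simp [Real.pi_pos.le]
  have hright : ∀ v, ∫ θ in Ioc 0 (2 * Real.pi), φ v * Real.log ‖circleMap 0 R θ - v‖ =
      2 * Real.pi * (φ v * Real.log (max R ‖v‖)) := by
    intro v
    have h1 := circleAverage_log_norm_sub_const_eq_log_radius_add_posLog (c := 0) (a := v) hR0.ne'
    rw [Real.circleAverage, intervalIntegral.integral_of_le hπ.le, smul_eq_mul,
      inv_mul_eq_iff_eq_mul₀ hπ.ne'] at h1
    rw [integral_const_mul, h1, Real.posLog_eq_log_max_one (by positivity), zero_sub, norm_neg,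
      ← Real.log_mul hR0.ne' (by positivity), mul_max_of_nonneg _ _ hR0.le, mul_one,
      mul_inv_cancel_left₀ hR0.ne']
    ring
  rw [hleft] at hswap
  simp only [hright, integral_const_mul] at hswap
  exact mul_left_cancel₀ hπ.ne' hswap

end

/-! ### Integrals against the Green function -/

/-- The function `log max(|x|, 1)`, which normalizes the Green function. -/
noncomputable def logMax (x : ℂ) : ℝ := Real.log (max ‖x‖ 1)

lemma continuous_logMax : Continuous logMax :=
  (continuous_norm.max continuous_const).log fun _ => (lt_max_of_lt_right one_pos).ne'

lemma greenFunction_eq {x w : ℂ} (h : w ≠ x) :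
    greenFunction x w = logMax x + logMax w - Real.log ‖x - w‖ := by
  have h1 : max ‖x‖ 1 ≠ 0 := (lt_max_of_lt_right one_pos).ne'
  have h2 : max ‖w‖ 1 ≠ 0 := (lt_max_of_lt_right one_pos).ne'
  rw [greenFunction, Real.log_div (mul_ne_zero h1 h2) (norm_ne_zero_iff.2 (sub_ne_zero.2 h.symm)),
    Real.log_mul h1 h2, logMax, logMax]

lemma integrable_mul_of_testFunction (φ : 𝓓((⊤ : Opens ℂ), ℝ)) {f : ℂ → ℝ} (hf : Continuous f) :
    Integrable fun x => φ x * f x :=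
  (φ.contDiff.continuous.mul hf).integrable_of_hasCompactSupport φ.hasCompactSupport.mul_right

lemma integrable_testFunction (φ : 𝓓((⊤ : Opens ℂ), ℝ)) : Integrable φ :=
  φ.contDiff.continuous.integrable_of_hasCompactSupport φ.hasCompactSupport

/-- The Green potential `x ↦ ∫ φ(v) G(x, v) dv` of a test function. -/
noncomputable def greenPotential (φ : 𝓓((⊤ : Opens ℂ), ℝ)) (x : ℂ) : ℝ :=
  ∫ v, φ v * greenFunction x v

lemma greenPotential_eq (φ : 𝓓((⊤ : Opens ℂ), ℝ)) (x : ℂ) :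
    greenPotential φ x = logMax x * (∫ v, φ v) + (∫ v, φ v * logMax v) - logPotential φ x := by
  have h1 : Integrable fun v => logMax x * φ v := (integrable_testFunction φ).const_mul _
  have h2 := integrable_mul_of_testFunction φ continuous_logMax
  have h3 := integrable_mul_log_norm_sub φ.contDiff.continuous φ.hasCompactSupport x
  have h12 : Integrable fun v => logMax x * φ v + φ v * logMax v := h1.add h2
  rw [logPotential, ← integral_const_mul, ← integral_add h1 h2, ← integral_sub h12 h3,
    greenPotential]
  refine integral_congr_ae ?_
  filter_upwards [compl_mem_ae_iff.2 (measure_singleton (μ := volume) x)] with v hv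
  rw [greenFunction_eq hv]
  ring

lemma continuous_greenPotential (φ : 𝓓((⊤ : Opens ℂ), ℝ)) : Continuous (greenPotential φ) := by
  rw [funext (greenPotential_eq φ)]
  exact ((continuous_logMax.mul continuous_const).add continuous_const).sub
    (continuous_logPotential φ.contDiff.continuous φ.hasCompactSupport)

lemma integral_integral_greenFunction (φ ψ : 𝓓((⊤ : Opens ℂ), ℝ)) :
    ∫ x, ∫ v, φ x * ψ v * greenFunction x v = ∫ x, φ x * greenPotential ψ x := by
  simp only [mul_assoc, integral_const_mul, greenPotential]

/-- The energy of a test function for the Green function. -/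
lemma integral_mul_greenPotential (φ : 𝓓((⊤ : Opens ℂ), ℝ)) :
    ∫ x, φ x * greenPotential φ x =
      2 * (∫ x, φ x) * (∫ x, φ x * logMax x) - ∫ x, φ x * logPotential φ x := by
  have h1 : Integrable fun x => φ x * logMax x * (∫ v, φ v) :=
    (integrable_mul_of_testFunction φ continuous_logMax).mul_const _
  have h2 : Integrable fun x => φ x * (∫ v, φ v * logMax v) :=
    (integrable_testFunction φ).mul_const _
  have h3 := integrable_mul_of_testFunction φ
    (continuous_logPotential φ.contDiff.continuous φ.hasCompactSupport)
  have h12 : Integrable fun x => φ x * logMax x * (∫ v, φ v) + φ x * (∫ v, φ v * logMax v) :=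
    h1.add h2
  have e : ∀ x, φ x * greenPotential φ x = φ x * logMax x * (∫ v, φ v) +
      φ x * (∫ v, φ v * logMax v) - φ x * logPotential φ x := fun x => by
    rw [greenPotential_eq]; ring
  simp only [e]
  rw [integral_sub h12 h3, integral_add h1 h2, integral_mul_const, integral_mul_const]
  ring

/-! ### Rescaled test functions -/

lemma rescaleTest_apply (r : ℝ) (hr : 0 < r) (z : ℂ) (φ : 𝓓((⊤ : Opens ℂ), ℝ)) (x : ℂ) :
    rescaleTest r hr z φ x = (r ^ 2)⁻¹ * φ (r⁻¹ • (x - z)) := rfl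

lemma integral_rescaleTest_mul {r : ℝ} (hr : 0 < r) (z : ℂ) (φ : 𝓓((⊤ : Opens ℂ), ℝ))
    (F : ℂ → ℝ) : ∫ x, rescaleTest r hr z φ x * F x = ∫ u, φ u * F (r • u + z) := by
  have h1 := integral_sub_right_eq_self (μ := volume)
    (fun x => (r ^ 2)⁻¹ * φ (r⁻¹ • x) * F (x + z)) z
  simp only [sub_add_cancel] at h1
  have h2 := Measure.integral_comp_inv_smul_of_nonneg (volume : Measure ℂ)
    (fun u => (r ^ 2)⁻¹ * φ u * F (r • u + z)) hr.le
  simp only [smul_inv_smul₀ hr.ne', Complex.finrank_real_complex, smul_eq_mul] at h2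
  simp only [rescaleTest_apply]
  rw [h1, h2, ← integral_const_mul]
  refine integral_congr_ae (Filter.Eventually.of_forall fun u => ?_)
  have : r ^ 2 ≠ 0 := by positivity
  simp only
  field_simp

lemma integral_rescaleTest {r : ℝ} (hr : 0 < r) (z : ℂ) (φ : 𝓓((⊤ : Opens ℂ), ℝ)) :
    ∫ x, rescaleTest r hr z φ x = ∫ u, φ u := by
  simpa using integral_rescaleTest_mul hr z φ fun _ => 1

lemma logPotential_rescaleTest {r : ℝ} (hr : 0 < r) (z : ℂ) (φ : 𝓓((⊤ : Opens ℂ), ℝ)) (y : ℂ) :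
    logPotential (rescaleTest r hr z φ) (r • y + z) =
      Real.log r * (∫ u, φ u) + logPotential φ y := by
  have h1 : Integrable fun v => Real.log r * φ v := (integrable_testFunction φ).const_mul _
  have h2 := integrable_mul_log_norm_sub φ.contDiff.continuous φ.hasCompactSupport y
  rw [logPotential, integral_rescaleTest_mul, logPotential, ← integral_const_mul,
    ← integral_add h1 h2]
  refine integral_congr_ae ?_
  filter_upwards [compl_mem_ae_iff.2 (measure_singleton (μ := volume) y)] with v hv
  have hne : ‖y - v‖ ≠ 0 := norm_ne_zero_iff.2 (sub_ne_zero.2 (Ne.symm hv))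
  rw [add_sub_add_right_eq_sub, ← smul_sub, norm_smul, Real.norm_of_nonneg hr.le,
    Real.log_mul hr.ne' hne]
  ring

/-- The energy of a rescaled test function for the Green function. -/
lemma integral_rescaleTest_mul_greenPotential {r : ℝ} (hr : 0 < r) (z : ℂ)
    (φ : 𝓓((⊤ : Opens ℂ), ℝ)) :
    ∫ x, rescaleTest r hr z φ x * greenPotential (rescaleTest r hr z φ) x =
      2 * (∫ x, φ x) * (∫ x, φ x * logMax (r • x + z)) - Real.log r * (∫ x, φ x) ^ 2
        - ∫ x, φ x * logPotential φ x := by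
  have h1 : Integrable fun x => φ x * (Real.log r * (∫ u, φ u)) :=
    (integrable_testFunction φ).mul_const _
  have h2 := integrable_mul_of_testFunction φ
    (continuous_logPotential φ.contDiff.continuous φ.hasCompactSupport)
  rw [integral_mul_greenPotential, integral_rescaleTest, integral_rescaleTest_mul,
    integral_rescaleTest_mul]
  simp only [logPotential_rescaleTest, mul_add]
  rw [integral_add h1 h2, integral_mul_const]
  ring

/-! ### Green potentials supported in a disc, up to a constant -/

/-- A radial test function which is positive exactly on the unit disc. -/
noncomputable def bump : 𝓓((⊤ : Opens ℂ), ℝ) where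
  toFun v := Real.smoothTransition (1 - ‖v‖ ^ 2)
  contDiff' := Real.smoothTransition.contDiff.comp (contDiff_const.sub (contDiff_norm_sq ℝ))
  hasCompactSupport' := HasCompactSupport.intro (isCompact_closedBall 0 1) fun v hv => by
    rw [mem_closedBall_zero_iff, not_le] at hv
    exact Real.smoothTransition.zero_of_nonpos (by nlinarith)
  tsupport_subset' := fun _ _ => trivial

lemma bump_apply (v : ℂ) : bump v = Real.smoothTransition (1 - ‖v‖ ^ 2) := rfl

lemma bump_nonneg (v : ℂ) : 0 ≤ bump v := Real.smoothTransition.nonneg _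

lemma bump_pos {v : ℂ} (hv : ‖v‖ < 1) : 0 < bump v :=
  Real.smoothTransition.pos_of_pos (by nlinarith [norm_nonneg v])

lemma bump_eq_zero {v : ℂ} (hv : 1 ≤ ‖v‖) : bump v = 0 :=
  Real.smoothTransition.zero_of_nonpos (by nlinarith)

lemma integral_bump_pos : 0 < ∫ v, bump v := by
  rw [integral_pos_iff_support_of_nonneg bump_nonneg (integrable_testFunction bump)]
  refine (Metric.measure_ball_pos volume (0 : ℂ) one_pos).trans_le (measure_mono fun v hv => ?_)
  exact (bump_pos (mem_ball_zero_iff.1 hv)).ne'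

lemma integrable_bump_mul_log_max {R a : ℝ} (hR : 0 ≤ R) (ha : 0 < a) :
    Integrable fun v : ℂ => bump v * Real.log (max R (a * ‖v‖)) := by
  rcases hR.eq_or_lt with rfl | hR
  · have h1 : Integrable fun v => bump v * Real.log a := (integrable_testFunction bump).mul_const _
    have h2 := integrable_mul_log_norm_sub bump.contDiff.continuous bump.hasCompactSupport 0
    refine (h1.add h2).congr ?_
    filter_upwards [compl_mem_ae_iff.2 (measure_singleton (μ := volume) (0 : ℂ))] with v hv
    rw [Pi.add_apply, max_eq_right (by positivity), Real.log_mul ha.ne' (norm_ne_zero_iff.2 hv),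
      zero_sub, norm_neg, mul_add]
  · refine integrable_mul_of_testFunction bump ?_
    exact (continuous_const.max (continuous_const.mul continuous_norm)).log
      fun v => (lt_max_of_lt_left hR).ne'

lemma logPotential_rescaleTest_bump {a : ℝ} (ha : 0 < a) (c x : ℂ) :
    logPotential (rescaleTest a ha c bump) x =
      ∫ v, bump v * Real.log (max ‖x - c‖ (a * ‖v‖)) := by
  have hx : x = a • (a⁻¹ • (x - c)) + c := by rw [smul_inv_smul₀ ha.ne', sub_add_cancel]
  have hrad : ∀ e : Circle, ∀ v, bump (e * v) = bump v := fun e v => by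
    rw [bump_apply, bump_apply, norm_mul, Circle.norm_coe, one_mul]
  have hn : ‖a⁻¹ • (x - c)‖ = a⁻¹ * ‖x - c‖ := by
    rw [norm_smul, Real.norm_of_nonneg (inv_nonneg.2 ha.le)]
  have h1 : Integrable fun v => Real.log a * bump v := (integrable_testFunction bump).const_mul _
  have h2 := integrable_bump_mul_log_max (R := a⁻¹ * ‖x - c‖) (by positivity) one_pos
  simp only [one_mul] at h2
  conv_lhs => rw [hx]
  rw [logPotential_rescaleTest, logPotential_radial bump.contDiff.continuous
    bump.hasCompactSupport hrad, hn, ← integral_const_mul, ← integral_add h1 h2]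
  refine integral_congr_ae ?_
  filter_upwards [compl_mem_ae_iff.2 (measure_singleton (μ := volume) (0 : ℂ))] with v hv
  have hpos : 0 < max (a⁻¹ * ‖x - c‖) ‖v‖ := lt_max_of_lt_right (norm_pos_iff.2 hv)
  have e : max ‖x - c‖ (a * ‖v‖) = a * max (a⁻¹ * ‖x - c‖) ‖v‖ := by
    rw [mul_max_of_nonneg _ _ ha.le, mul_inv_cancel_left₀ ha.ne']
  rw [e, Real.log_mul ha.ne' hpos.ne']
  ring

/-- The difference of two concentric radial bumps of the same mass has a Green potential which is,
up to an additive constant, nonnegative, and positive exactly on the larger disc. -/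
lemma exists_greenPotential_bump (c : ℂ) {r : ℝ} (hr : 0 < r) :
    ∃ (ψ : 𝓓((⊤ : Opens ℂ), ℝ)) (C M : ℝ), (∀ x, |greenPotential ψ x| ≤ M) ∧
      (∀ x ∉ Metric.ball c r, greenPotential ψ x = C) ∧
      ∀ x ∈ Metric.ball c r, C < greenPotential ψ x := by
  have hr2 : 0 < r / 2 := half_pos hr
  set ψ : 𝓓((⊤ : Opens ℂ), ℝ) := rescaleTest (r / 2) hr2 c bump - rescaleTest r hr c bump with hψ
  have hψa : ∀ v, ψ v = rescaleTest (r / 2) hr2 c bump v - rescaleTest r hr c bump v :=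
    fun v => rfl
  have hint : ∫ v, ψ v = 0 := by
    simp only [hψa]
    rw [integral_sub (integrable_testFunction _) (integrable_testFunction _),
      integral_rescaleTest, integral_rescaleTest, sub_self]
  set C := ∫ v, ψ v * logMax v with hC
  have hG : ∀ x, greenPotential ψ x = C +
      ∫ v, bump v * (Real.log (max ‖x - c‖ (r * ‖v‖)) -
        Real.log (max ‖x - c‖ (r / 2 * ‖v‖))) := by
    intro x
    have e : logPotential ψ x = logPotential (rescaleTest (r / 2) hr2 c bump) x -
        logPotential (rescaleTest r hr c bump) x := by
      rw [logPotential, logPotential, logPotential, ← integral_sub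
        (integrable_mul_log_norm_sub (TestFunction.contDiff _).continuous
          (TestFunction.hasCompactSupport _) _)
        (integrable_mul_log_norm_sub (TestFunction.contDiff _).continuous
          (TestFunction.hasCompactSupport _) _)]
      simp only [hψa, sub_mul]
    simp only [mul_sub]
    rw [integral_sub (integrable_bump_mul_log_max (norm_nonneg _) hr)
      (integrable_bump_mul_log_max (norm_nonneg _) hr2), greenPotential_eq, hint, e,
      logPotential_rescaleTest_bump, logPotential_rescaleTest_bump]
    ring
  have hout : ∀ x ∉ Metric.ball c r, greenPotential ψ x = C := by
    intro x hx
    rw [Metric.mem_ball, not_lt, dist_eq_norm] at hx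
    rw [hG, add_eq_left]
    refine integral_eq_zero_of_ae (Filter.Eventually.of_forall fun v => ?_)
    rcases le_or_gt 1 ‖v‖ with hv | hv
    · simp [bump_eq_zero hv]
    · have h1 : r * ‖v‖ ≤ r := mul_le_of_le_one_right hr.le hv.le
      have h2 : r / 2 * ‖v‖ ≤ r := by nlinarith [norm_nonneg v]
      simp [max_eq_left (h1.trans hx), max_eq_left (h2.trans hx)]
  have hin : ∀ x ∈ Metric.ball c r, C < greenPotential ψ x := by
    intro x hx
    rw [Metric.mem_ball, dist_eq_norm] at hx
    rw [hG, lt_add_iff_pos_right]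
    have hmono : ∀ v : ℂ, v ≠ 0 → Real.log (max ‖x - c‖ (r / 2 * ‖v‖)) ≤
        Real.log (max ‖x - c‖ (r * ‖v‖)) := by
      intro v hv
      have hv' := norm_pos_iff.2 hv
      refine Real.log_le_log (lt_max_of_lt_right (by positivity)) (max_le_max le_rfl ?_)
      nlinarith
    rw [integral_pos_iff_support_of_nonneg_ae]
    · have hopen : IsOpen {v : ℂ | ‖x - c‖ / r < ‖v‖ ∧ ‖v‖ < 1} :=
        (isOpen_lt continuous_const continuous_norm).inter
          (isOpen_lt continuous_norm continuous_const)
      have hne : {v : ℂ | ‖x - c‖ / r < ‖v‖ ∧ ‖v‖ < 1}.Nonempty := by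
        obtain ⟨t, ht, ht'⟩ := exists_between ((div_lt_one hr).2 hx)
        have ht0 : 0 ≤ t := le_trans (by positivity) ht.le
        refine ⟨(t : ℂ), ?_, ?_⟩ <;> simpa [abs_of_nonneg ht0] using by assumption
      refine (hopen.measure_pos volume hne).trans_le (measure_mono fun v hv => ?_)
      obtain ⟨hv1, hv2⟩ := hv
      rw [div_lt_iff₀ hr, mul_comm] at hv1
      have hv0 : 0 < ‖v‖ := by
        by_contra h
        have : ‖v‖ = 0 := le_antisymm (not_lt.1 h) (norm_nonneg v)
        rw [this, mul_zero] at hv1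
        exact (norm_nonneg _).not_gt hv1
      have hlt : Real.log (max ‖x - c‖ (r / 2 * ‖v‖)) < Real.log (max ‖x - c‖ (r * ‖v‖)) := by
        refine Real.log_lt_log (lt_max_of_lt_right (by positivity)) ?_
        refine (max_lt hv1 ?_).trans_le (le_max_right _ _)
        nlinarith
      exact (mul_pos (bump_pos hv2) (sub_pos.2 hlt)).ne'
    · filter_upwards [compl_mem_ae_iff.2 (measure_singleton (μ := volume) (0 : ℂ))] with v hv
      exact mul_nonneg (bump_nonneg v) (sub_nonneg.2 (hmono v hv))
    · simp only [mul_sub]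
      exact (integrable_bump_mul_log_max (norm_nonneg _) hr).sub
        (integrable_bump_mul_log_max (norm_nonneg _) hr2)
  obtain ⟨M, hM⟩ := (isCompact_closedBall c r).exists_bound_of_continuousOn
    (continuous_greenPotential ψ).continuousOn
  refine ⟨ψ, C, max M |C|, fun x => ?_, hout, hin⟩
  by_cases hx : x ∈ Metric.ball c r
  · exact (hM x (Metric.ball_subset_closedBall hx)).trans (le_max_left _ _)
  · rw [hout x hx]
    exact le_max_right _ _

namespace PlaneMetric

/-- Distinct geodesics are told apart by the integrals of suitable Green potentials: a small disc
with rational data meets one of them and not the other. -/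
lemma eqOn_of_integral_eq {d : PlaneMetric} {z w : ℂ} {I : Set ℂ} (hI : Dense I)
    {P₁ P₂ : ℝ → ℂ} (h₁ : d.IsLengthParam z w (d.dist z w) P₁)
    (h₂ : d.IsLengthParam z w (d.dist z w) P₂)
    (hsep : ∀ c ∈ I, ∀ q : ℚ, 0 < q → ∃ (f : ℂ → ℝ) (C : ℝ), Continuous f ∧
      (∀ x ∉ Metric.ball c (q : ℝ), f x = C) ∧ (∀ x ∈ Metric.ball c (q : ℝ), C < f x) ∧
      ∫ t in Icc 0 (d.dist z w), f (P₁ t) = ∫ t in Icc 0 (d.dist z w), f (P₂ t)) :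
    EqOn P₁ P₂ (Icc 0 (d.dist z w)) := by
  intro s hs
  by_contra hne
  set L := d.dist z w
  have hdist : ∀ {P : ℝ → ℂ}, d.IsLengthParam z w L P → ∀ t ∈ Icc 0 L, d.dist z (P t) = t := by
    intro P hP t ht
    have := dist_eq_of_dist_le hP.source hP.target (fun _ _ => hP.dist_le) le_rfl ht.1 ht.2
    rwa [hP.source, sub_zero] at this
  have hK : IsCompact (P₂ '' Icc 0 L) := isCompact_Icc.image_of_continuousOn h₂.continuousOn
  have hnot : P₁ s ∉ P₂ '' Icc 0 L := by
    rintro ⟨t, ht, hts⟩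
    have : t = s := by rw [← hdist h₂ t ht, hts, hdist h₁ s hs]
    exact hne (by rw [← hts, this])
  obtain ⟨ε, hε, hball⟩ := Metric.isOpen_iff.1 hK.isClosed.isOpen_compl _ hnot
  obtain ⟨q, hq, hq'⟩ := exists_rat_btwn (half_pos hε)
  have hq0 : (0 : ℚ) < q := by exact_mod_cast hq
  obtain ⟨c, hc, hcI⟩ := hI.exists_mem_open Metric.isOpen_ball
    ⟨P₁ s, Metric.mem_ball_self (ε := (q : ℝ)) hq⟩
  obtain ⟨f, C, hf, hout, hin, heq⟩ := hsep c hc q hq0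
  have hsc : P₁ s ∈ Metric.ball c (q : ℝ) := Metric.mem_ball_comm.1 hcI
  have hle : ∀ x, C ≤ f x := fun x => by
    by_cases hx : x ∈ Metric.ball c (q : ℝ)
    · exact (hin x hx).le
    · exact (hout x hx).ge
  have hL : 0 < L := by
    by_contra h
    have hL0 : L = 0 := le_antisymm (not_lt.1 h) h₁.nonneg
    have hs0 : s = 0 := le_antisymm (hL0 ▸ hs.2) hs.1
    exact hne (by rw [hs0, h₁.source, h₂.source])
  have e₂ : ∫ t in Icc 0 L, f (P₂ t) = ∫ t in Icc 0 L, C := by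
    refine setIntegral_congr_fun measurableSet_Icc fun t ht => hout _ fun hmem => ?_
    have h3 := dist_triangle_right (P₂ t) (P₁ s) c
    have h4 : P₂ t ∈ Metric.ball (P₁ s) ε := by
      rw [Metric.mem_ball] at hmem hsc ⊢
      linarith
    exact hball h4 ⟨t, ht, rfl⟩
  have e₁ : ∫ t in Icc 0 L, C < ∫ t in Icc 0 L, f (P₁ t) := by
    rw [integral_Icc_eq_integral_Ioc, integral_Icc_eq_integral_Ioc,
      ← intervalIntegral.integral_of_le hL.le, ← intervalIntegral.integral_of_le hL.le]
    exact intervalIntegral.integral_lt_integral_of_continuousOn_of_le_of_exists_lt hL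
      continuousOn_const (hf.comp_continuousOn h₁.continuousOn) (fun x _ => hle _)
      ⟨s, hs, hin _ hsc⟩
  rw [heq, e₂] at e₁
  exact lt_irrefl _ e₁

end PlaneMetric

/-! ### Measures on the space of distributions -/

lemma add_apply (T S : PlaneDistribution) (φ : 𝓓((⊤ : Opens ℂ), ℝ)) : (T + S) φ = T φ + S φ := rfl

lemma ofContinuous_smul_apply (s : ℝ) (f : C(ℂ, ℝ)) (φ : 𝓓((⊤ : Opens ℂ), ℝ)) :
    ofContinuous (s • f) φ = s * ofContinuous f φ := by
  simp only [ofContinuous_apply, ContinuousMap.smul_apply, smul_eq_mul, ← integral_const_mul]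
  exact integral_congr_ae (Filter.Eventually.of_forall fun x => mul_left_comm _ _ _)

lemma ofContinuous_const_apply (c : ℝ) (φ : 𝓓((⊤ : Opens ℂ), ℝ)) :
    ofContinuous (ContinuousMap.const ℂ c) φ = c * ∫ x, φ x := by
  simp only [ofContinuous_apply, ContinuousMap.const_apply, integral_mul_const, mul_comm c]

lemma ofContinuous_add (f g : C(ℂ, ℝ)) :
    ofContinuous (f + g) = ofContinuous f + ofContinuous g := by
  ext φ
  rw [add_apply]
  simp only [ofContinuous_apply, ContinuousMap.add_apply, mul_add]
  exact integral_add (integrable_mul_of_testFunction φ f.continuous)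
    (integrable_mul_of_testFunction φ g.continuous)

lemma ofContinuous_zero : ofContinuous 0 = 0 := by
  ext φ
  simp [ofContinuous_apply]

lemma measurable_eval (φ : 𝓓((⊤ : Opens ℂ), ℝ)) : Measurable fun T : PlaneDistribution => T φ :=
  (comap_measurable _).mono (le_iSup (fun φ : 𝓓((⊤ : Opens ℂ), ℝ) =>
    MeasurableSpace.comap (fun T : PlaneDistribution => T φ) inferInstance) φ) le_rfl

lemma measurable_distribution_iff {α : Type*} [MeasurableSpace α] {F : α → PlaneDistribution} :
    Measurable F ↔ ∀ φ, Measurable fun a => F a φ := by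
  refine ⟨fun h φ => (measurable_eval φ).comp h, fun h => ?_⟩
  rw [measurable_iff_comap_le, distributionMeasurableSpace, MeasurableSpace.comap_iSup]
  refine iSup_le fun φ => ?_
  rw [MeasurableSpace.comap_comp]
  exact (h φ).comap_le

/-- The σ-algebra of the space of distributions is induced by the product σ-algebra. -/
lemma distributionMeasurableSpace_eq_comap :
    (inferInstance : MeasurableSpace PlaneDistribution) =
      MeasurableSpace.comap (fun (T : PlaneDistribution) (φ : 𝓓((⊤ : Opens ℂ), ℝ)) => T φ)
        MeasurableSpace.pi := by
  simp only [MeasurableSpace.pi, MeasurableSpace.comap_iSup, MeasurableSpace.comap_comp]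
  rfl

lemma measurable_eval_pi :
    Measurable fun (T : PlaneDistribution) (φ : 𝓓((⊤ : Opens ℂ), ℝ)) => T φ :=
  measurable_pi_iff.2 measurable_eval

/-- By linearity and the Cramér-Wold device, the law of a random distribution is determined by
the laws of the individual pairings. -/
lemma measure_distribution_ext {P Q : Measure PlaneDistribution} [IsProbabilityMeasure P]
    [IsProbabilityMeasure Q]
    (h : ∀ φ : 𝓓((⊤ : Opens ℂ), ℝ), P.map (fun T => T φ) = Q.map fun T => T φ) : P = Q := by
  set ev := fun (T : PlaneDistribution) (φ : 𝓓((⊤ : Opens ℂ), ℝ)) => T φ with hev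
  have hfin : ∀ I : Finset 𝓓((⊤ : Opens ℂ), ℝ),
      (P.map ev).map I.restrict = (Q.map ev).map I.restrict := by
    intro I
    have hm : Measurable fun T : PlaneDistribution => I.restrict (ev T) :=
      (Finset.measurable_restrict I).comp measurable_eval_pi
    rw [Measure.map_map (Finset.measurable_restrict I) measurable_eval_pi,
      Measure.map_map (Finset.measurable_restrict I) measurable_eval_pi]
    have := Measure.isProbabilityMeasure_map (μ := P) hm.aemeasurable
    have := Measure.isProbabilityMeasure_map (μ := Q) hm.aemeasurable
    refine Measure.ext_of_charFunDual ?_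
    ext ℓ
    change charFunDual (P.map fun T => I.restrict (ev T)) ℓ =
      charFunDual (Q.map fun T => I.restrict (ev T)) ℓ
    rw [charFunDual_eq_charFun_map_one, charFunDual_eq_charFun_map_one,
      Measure.map_map ℓ.continuous.measurable hm, Measure.map_map ℓ.continuous.measurable hm]
    classical
    have e : (ℓ ∘ fun T : PlaneDistribution => I.restrict (ev T)) =
        fun T : PlaneDistribution =>
          T (∑ i : I, ℓ (Pi.single i 1) • (i : 𝓓((⊤ : Opens ℂ), ℝ))) := by
      funext T
      have h1 : I.restrict (ev T) = ∑ i : I, T (i : 𝓓((⊤ : Opens ℂ), ℝ)) • Pi.single i (1 : ℝ) := by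
        funext j
        simp [Finset.sum_apply, Pi.single_apply, ev]
      have h2 : ∀ S : 𝓓((⊤ : Opens ℂ), ℝ) →L[ℝ] ℝ,
          S (∑ i : I, ℓ (Pi.single i 1) • (i : 𝓓((⊤ : Opens ℂ), ℝ))) =
            ∑ i : I, ℓ (Pi.single i 1) * S i := fun S => by
        simp [map_sum]
      refine Eq.trans ?_ (h2 T).symm
      rw [Function.comp_apply, h1, map_sum]
      refine Finset.sum_congr rfl fun i _ => ?_
      rw [map_smul, smul_eq_mul, mul_comm]
      rfl
    rw [e, h]
  have hpi : P.map ev = Q.map ev := by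
    have := Measure.isProbabilityMeasure_map (μ := P) measurable_eval_pi.aemeasurable
    have := Measure.isProbabilityMeasure_map (μ := Q) measurable_eval_pi.aemeasurable
    exact IsProjectiveLimit.unique (P := fun I => (Q.map ev).map I.restrict) hfin fun I => rfl
  ext s hs
  obtain ⟨t, ht, rfl⟩ : ∃ t, MeasurableSet t ∧ ev ⁻¹' t = s :=
    distributionMeasurableSpace_eq_comap.le _ hs
  rw [← Measure.map_apply measurable_eval_pi ht, ← Measure.map_apply measurable_eval_pi ht]
  exact congrArg (fun m => m t) hpi

/-- Gluing of a measure on `α` with a joint law whose first marginal is the law of `X`. -/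
lemma exists_measure_prod_of_map_eq {α β E : Type*} [MeasurableSpace α] [MeasurableSpace β]
    [MeasurableSpace E] {P : Measure α} {Q : Measure β} [IsProbabilityMeasure P]
    [IsProbabilityMeasure Q] {X : α → E} {Y : β → E} {C : β → ℝ} (hX : Measurable X)
    (hY : Measurable Y) (hC : Measurable C) (h : P.map X = Q.map Y) :
    ∃ ν : Measure (α × ℝ), ν.map Prod.fst = P ∧
      ν.map (fun p => (X p.1, p.2)) = Q.map fun b => (Y b, C b) := by
  set κ := condDistrib C Y Q
  refine ⟨P ⊗ₘ κ.comap X hX, Measure.fst_compProd _ _, ?_⟩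
  have := Measure.isProbabilityMeasure_map (μ := Q) hY.aemeasurable
  have hm : Measurable fun p : α × ℝ => (X p.1, p.2) :=
    (hX.comp measurable_fst).prodMk measurable_snd
  rw [← compProd_map_condDistrib hC.aemeasurable, ← h]
  have := Measure.isProbabilityMeasure_map (μ := P) hX.aemeasurable
  ext s hs
  rw [Measure.map_apply hm hs, Measure.compProd_apply (hm hs), Measure.compProd_apply hs,
    lintegral_map (Kernel.measurable_kernel_prodMk_left hs) hX]
  rfl

/-! ### The Gaussian free field -/

lemma greenPotential_smul (c : ℝ) (ψ : 𝓓((⊤ : Opens ℂ), ℝ)) (x : ℂ) :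
    greenPotential (c • ψ) x = c * greenPotential ψ x := by
  rw [greenPotential, greenPotential, ← integral_const_mul]
  exact integral_congr_ae (Filter.Eventually.of_forall fun v => mul_assoc _ _ _)

section GFF

variable {P : Measure PlaneDistribution}

lemma IsWholePlaneGFF.isProbabilityMeasure (hP : IsWholePlaneGFF P id) :
    IsProbabilityMeasure P :=
  hP.gaussian.isProbabilityMeasure

lemma IsWholePlaneGFF.hasGaussianLaw (hP : IsWholePlaneGFF P id) (φ : 𝓓((⊤ : Opens ℂ), ℝ)) :
    HasGaussianLaw (fun T : PlaneDistribution => T φ) P :=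
  hP.gaussian.hasGaussianLaw_eval φ

lemma IsWholePlaneGFF.covariance (hP : IsWholePlaneGFF P id) (φ ψ : 𝓓((⊤ : Opens ℂ), ℝ)) :
    cov[fun T : PlaneDistribution => T φ, fun T : PlaneDistribution => T ψ; P] =
      ∫ x, φ x * greenPotential ψ x :=
  (hP.covariance_eq φ ψ).trans (integral_integral_greenFunction φ ψ)

lemma IsWholePlaneGFF.variance (hP : IsWholePlaneGFF P id) (φ : 𝓓((⊤ : Opens ℂ), ℝ)) :
    Var[fun T : PlaneDistribution => T φ; P] = ∫ x, φ x * greenPotential φ x := by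
  rw [← hP.covariance, covariance_self (hP.hasGaussianLaw φ).aemeasurable]

lemma IsWholePlaneGFF.map_eval (hP : IsWholePlaneGFF P id) (φ : 𝓓((⊤ : Opens ℂ), ℝ)) :
    P.map (fun T : PlaneDistribution => T φ) =
      gaussianReal 0 (∫ x, φ x * greenPotential φ x).toNNReal := by
  have h := (hP.hasGaussianLaw φ).map_eq_gaussianReal
  rw [hP.variance] at h
  have h0 : ∫ T : PlaneDistribution, T φ ∂P = 0 := hP.centered φ
  rwa [h0] at h

/-- A test function whose pairing with the field vanishes has a vanishing Green potential. -/
lemma IsWholePlaneGFF.greenPotential_eq_zero (hP : IsWholePlaneGFF P id)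
    {ψ : 𝓓((⊤ : Opens ℂ), ℝ)}
    (hψ : ∫ x, ψ x * greenPotential ψ x = 0) (x : ℂ) : greenPotential ψ x = 0 := by
  have hz : ∀ᵐ T : PlaneDistribution ∂P, T ψ = 0 := by
    have h := hP.map_eval ψ
    rw [hψ, Real.toNNReal_zero, gaussianReal_zero_var] at h
    refine ae_of_ae_map (f := fun T : PlaneDistribution => T ψ) (p := fun x => x = 0)
      (measurable_eval ψ).aemeasurable ?_
    rw [h]
    exact (ae_dirac_iff (p := fun y : ℝ => y = 0) (measurableSet_singleton 0)).2 rfl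
  have hint : ∀ φ : 𝓓((⊤ : Opens ℂ), ℝ), ∫ x, φ x * greenPotential ψ x = 0 := by
    intro φ
    have h0 : ∫ T : PlaneDistribution, T ψ ∂P = 0 := hP.centered ψ
    rw [← hP.covariance, ProbabilityTheory.covariance, h0]
    refine integral_eq_zero_of_ae ?_
    filter_upwards [hz] with T hT
    simp [hT]
  have hcont := continuous_greenPotential ψ
  have hae : ∀ᵐ x, greenPotential ψ x = 0 :=
    ae_eq_zero_of_integral_contDiff_smul_eq_zero hcont.locallyIntegrable fun g hg hgc =>
      hint ⟨g, hg, hgc, fun _ _ => trivial⟩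
  exact congrFun (Measure.eq_of_ae_eq (μ := volume) hae hcont continuous_const) x

/-- Averaging over a line. If the potential `f` of `ψ` is not zero, then the field is the sum of
`Z f`, where the Gaussian variable `Z` is a multiple of the pairing with `ψ`, and of an independent
field. A measurable set which almost surely meets the line through the field in direction `f` in a
Lebesgue null set is therefore null. -/
theorem IsWholePlaneGFF.ae_notMem_of_ae_line (hP : IsWholePlaneGFF P id)
    {ψ : 𝓓((⊤ : Opens ℂ), ℝ)} {f : C(ℂ, ℝ)}
    (hf : ∀ x, f x = greenPotential ψ x) (hne : ∃ x, greenPotential ψ x ≠ 0)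
    {E : Set PlaneDistribution} (hE : MeasurableSet E)
    (h : ∀ᵐ T ∂P, ∀ᵐ s : ℝ, T + ofContinuous (s • f) ∉ E) : ∀ᵐ T ∂P, T ∉ E := by
  have := hP.isProbabilityMeasure
  set v := ∫ x, ψ x * greenPotential ψ x with hv
  have hv0 : v ≠ 0 := fun h0 => by
    obtain ⟨x, hx⟩ := hne
    exact hx (hP.greenPotential_eq_zero h0 x)
  have hofc : ∀ χ, ofContinuous f χ = ∫ x, χ x * greenPotential ψ x := fun χ => by
    simp only [ofContinuous_apply, hf]
  let Z : PlaneDistribution → ℝ := fun T => T (v⁻¹ • ψ)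
  let R : PlaneDistribution → PlaneDistribution := fun T => T + ofContinuous ((-Z T) • f)
  have hZm : Measurable Z := measurable_eval _
  have hadd : Measurable fun p : PlaneDistribution × ℝ => p.1 + ofContinuous (p.2 • f) := by
    rw [measurable_distribution_iff]
    intro φ
    simp only [add_apply, ofContinuous_smul_apply]
    exact ((measurable_eval φ).comp measurable_fst).add (measurable_snd.mul_const _)
  have hRm : Measurable R := hadd.comp (measurable_id.prodMk hZm.neg)
  have hRχ : ∀ T χ, R T χ = T (χ - (ofContinuous f χ * v⁻¹) • ψ) := by
    intro T χ
    have e1 : T (χ - (ofContinuous f χ * v⁻¹) • ψ) =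
        T χ - (ofContinuous f χ * v⁻¹) * T ψ := by
      rw [map_sub, map_smul, smul_eq_mul]
    have e2 : Z T = v⁻¹ * T ψ := by
      simp only [Z, map_smul, smul_eq_mul]
    rw [e1, add_apply, ofContinuous_smul_apply, e2]
    ring
  have hind : IndepFun R Z P := by
    have hgauss : IsGaussianProcess (Sum.elim (fun χ T => R T χ) fun (_ : Unit) T => Z T) P := by
      have heq : (Sum.elim (fun χ T => R T χ) fun (_ : Unit) T => Z T) =
          (fun (φ : 𝓓((⊤ : Opens ℂ), ℝ)) (T : PlaneDistribution) => T φ) ∘ Sum.elim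
            (fun χ => χ - (ofContinuous f χ * v⁻¹) • ψ) fun _ : Unit => v⁻¹ • ψ := by
        funext i T
        rcases i with χ | u
        · exact hRχ T χ
        · rfl
      rw [heq]
      exact hP.gaussian.comp_right _
    have h1 := hgauss.indepFun_of_covariance_eq_zero
      (fun χ => ((measurable_eval χ).comp hRm).aemeasurable) (fun _ => hZm.aemeasurable) ?_
    · have h2 := h1.comp measurable_id (measurable_pi_apply ())
      rw [IndepFun_iff_Indep] at h2 ⊢
      refine indep_of_indep_of_le_left h2 ?_
      exact (MeasurableSpace.comap_mono distributionMeasurableSpace_eq_comap.le).trans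
        MeasurableSpace.comap_comp.le
    · intro χ _
      simp only [hRχ]
      rw [hP.covariance]
      have h1 := integrable_mul_of_testFunction χ (continuous_greenPotential ψ)
      have h2 := integrable_mul_of_testFunction ψ (continuous_greenPotential ψ)
      have e : ∀ x, (χ - (ofContinuous f χ * v⁻¹) • ψ) x * greenPotential (v⁻¹ • ψ) x =
          v⁻¹ * (χ x * greenPotential ψ x -
            ofContinuous f χ * v⁻¹ * (ψ x * greenPotential ψ x)) := fun x => by
        rw [greenPotential_smul]
        change (χ x - ofContinuous f χ * v⁻¹ * ψ x) * _ = _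
        ring
      simp only [e]
      rw [integral_const_mul, integral_sub h1 (h2.const_mul _), integral_const_mul, ← hv, hofc,
        mul_assoc, inv_mul_cancel₀ hv0, mul_one, sub_self, mul_zero]
  have hlaw := (indepFun_iff_map_prod_eq_prod_map_map hRm.aemeasurable hZm.aemeasurable).1 hind
  set A : Set (PlaneDistribution × ℝ) := {p | p.1 + ofContinuous (p.2 • f) ∈ E} with hA
  have hAm : MeasurableSet A := hadd hE
  have hRZ : ∀ T s, R T + ofContinuous (s • f) = T + ofContinuous ((s - Z T) • f) := by
    intro T s
    rw [sub_smul, sub_eq_add_neg, ← neg_smul, ofContinuous_add, add_assoc,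
      add_comm (ofContinuous (s • f))]
  have hZac : P.map Z ≪ volume := by
    have e : ∫ x, (v⁻¹ • ψ) x * greenPotential (v⁻¹ • ψ) x = v⁻¹ := by
      have e : ∀ x, (v⁻¹ • ψ) x * greenPotential (v⁻¹ • ψ) x =
          v⁻¹ * v⁻¹ * (ψ x * greenPotential ψ x) := fun x => by
        rw [greenPotential_smul]
        change v⁻¹ * ψ x * _ = _
        ring
      simp only [e]
      rw [integral_const_mul, ← hv, mul_assoc, inv_mul_cancel₀ hv0, mul_one]
    have hvpos : 0 < v := lt_of_le_of_ne (hv ▸ hP.variance ψ ▸ variance_nonneg _ _) hv0.symm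
    rw [hP.map_eval, e]
    exact gaussianReal_absolutelyContinuous _ (Real.toNNReal_pos.2 (inv_pos.2 hvpos)).ne'
  have hnull : (P.map R).prod (P.map Z) A = 0 := by
    rw [Measure.measure_prod_null hAm]
    have hms : MeasurableSet {S | (P.map Z) (Prod.mk S ⁻¹' A) = 0} :=
      measurable_measure_prodMk_left hAm (measurableSet_singleton 0)
    refine (ae_map_iff hRm.aemeasurable hms).2 ?_
    filter_upwards [h] with T hT
    refine hZac ?_
    have := (measurePreserving_sub_right volume (Z T)).quasiMeasurePreserving.ae hT
    refine measure_mono_null (fun s hs => ?_) this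
    simp only [mem_preimage, hA, mem_ofPred_eq, hRZ] at hs
    simpa using hs
  rw [← hlaw, Measure.map_apply (hRm.prodMk hZm) hAm] at hnull
  refine measure_mono_null (fun T hT => ?_) hnull
  have hT' : T ∈ E := by simpa using hT
  have : R T + ofContinuous (Z T • f) = T := by
    rw [hRZ, sub_self, zero_smul, ofContinuous_zero, add_zero]
  simpa [hA, this] using hT'

end GFF

/-! ### Scaling of the Gaussian free field -/

/-- A probability density which is a test function supported in the unit disc. -/
noncomputable def bumpDensity : 𝓓((⊤ : Opens ℂ), ℝ) := (∫ v, bump v)⁻¹ • bump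

lemma bumpDensity_apply (v : ℂ) : bumpDensity v = (∫ v, bump v)⁻¹ * bump v := rfl

lemma bumpDensity_nonneg (v : ℂ) : 0 ≤ bumpDensity v :=
  mul_nonneg (inv_nonneg.2 integral_bump_pos.le) (bump_nonneg v)

lemma integral_bumpDensity : ∫ v, bumpDensity v = 1 := by
  simp only [bumpDensity_apply, integral_const_mul]
  exact inv_mul_cancel₀ integral_bump_pos.ne'

/-- The field recentered to have average zero against `bumpDensity`. -/
noncomputable def recenter (T : PlaneDistribution) : PlaneDistribution :=
  T + ofContinuous (ContinuousMap.const ℂ (-T bumpDensity))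

lemma recenter_apply (T : PlaneDistribution) (φ : 𝓓((⊤ : Opens ℂ), ℝ)) :
    recenter T φ = T (φ - (∫ x, φ x) • bumpDensity) := by
  have e : T (φ - (∫ x, φ x) • bumpDensity) = T φ - (∫ x, φ x) * T bumpDensity := by
    rw [map_sub, map_smul, smul_eq_mul]
  rw [e, recenter, add_apply, ofContinuous_const_apply]
  ring

lemma measurable_add_const :
    Measurable fun p : PlaneDistribution × ℝ => p.1 + ofContinuous (ContinuousMap.const ℂ p.2) := by
  rw [measurable_distribution_iff]
  intro φ
  simp only [add_apply, ofContinuous_const_apply]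
  exact ((measurable_eval φ).comp measurable_fst).add (measurable_snd.mul_const _)

lemma measurable_recenter : Measurable recenter :=
  measurable_add_const.comp (measurable_id.prodMk (measurable_eval bumpDensity).neg)

lemma measurable_affineComp {r : ℝ} (hr : 0 < r) (z : ℂ) : Measurable (affineComp r hr z) :=
  measurable_distribution_iff.2 fun φ => by
    simp only [affineComp_apply]
    exact measurable_eval _

lemma add_const_add_const (T : PlaneDistribution) (a b : ℝ) :
    T + ofContinuous (ContinuousMap.const ℂ a) + ofContinuous (ContinuousMap.const ℂ b) =
      T + ofContinuous (ContinuousMap.const ℂ (a + b)) := by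
  rw [add_assoc, ← ofContinuous_add]
  rfl

lemma recenter_add_const (T : PlaneDistribution) (c : ℝ) :
    recenter T + ofContinuous (ContinuousMap.const ℂ (T bumpDensity + c)) =
      T + ofContinuous (ContinuousMap.const ℂ c) := by
  rw [recenter, add_const_add_const, neg_add_cancel_left]

section GFF

variable {P : Measure PlaneDistribution}

/-- The whole-plane GFF is invariant in law under scaling and translation, up to an additive
constant. -/
lemma IsWholePlaneGFF.map_recenter_affineComp (hP : IsWholePlaneGFF P id)
    {r : ℝ} (hr : 0 < r) (z : ℂ) :
    P.map recenter = P.map fun T => recenter (affineComp r hr z T) := by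
  have := hP.isProbabilityMeasure
  have hm := measurable_recenter.comp (measurable_affineComp hr z)
  have := Measure.isProbabilityMeasure_map (μ := P) measurable_recenter.aemeasurable
  have := Measure.isProbabilityMeasure_map (μ := P) hm.aemeasurable
  refine measure_distribution_ext (Q := P.map (recenter ∘ affineComp r hr z)) fun φ => ?_
  rw [Measure.map_map (measurable_eval φ) measurable_recenter,
    Measure.map_map (measurable_eval φ) hm]
  set φ₀ := φ - (∫ x, φ x) • bumpDensity with hφ₀
  have h0 : ∫ x, φ₀ x = 0 := by
    have e : ∀ x, φ₀ x = φ x - (∫ x, φ x) * bumpDensity x := fun x => rfl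
    simp only [e]
    rw [integral_sub (integrable_testFunction φ) ((integrable_testFunction _).const_mul _),
      integral_const_mul, integral_bumpDensity, mul_one, sub_self]
  have e1 : ((fun T : PlaneDistribution => T φ) ∘ recenter) = fun T => T φ₀ :=
    funext fun T => recenter_apply T φ
  have e2 : ((fun T : PlaneDistribution => T φ) ∘ (recenter ∘ affineComp r hr z)) =
      fun T => T (rescaleTest r hr z φ₀) := funext fun T => by
    rw [Function.comp_apply, Function.comp_apply, recenter_apply, affineComp_apply]
  rw [e1, e2, hP.map_eval, hP.map_eval, integral_mul_greenPotential,
    integral_rescaleTest_mul_greenPotential, h0]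
  simp

lemma IsWholePlaneGFF.variance_affineComp_le (hP : IsWholePlaneGFF P id) (z : ℂ) :
    ∃ A : ℝ, ∀ (t : ℝ), 0 ≤ t →
    Var[fun T => affineComp (Real.exp t) (Real.exp_pos t) z T bumpDensity; P] ≤ t + A := by
  refine ⟨2 * Real.log (2 + ‖z‖) - ∫ x, bumpDensity x * logPotential bumpDensity x, fun t ht => ?_⟩
  simp only [affineComp_apply]
  rw [hP.variance, integral_rescaleTest_mul_greenPotential, integral_bumpDensity, Real.log_exp]
  have hr : 1 ≤ Real.exp t := Real.one_le_exp ht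
  have h : ∫ x, bumpDensity x * logMax (Real.exp t • x + z) ≤ t + Real.log (2 + ‖z‖) := by
    calc ∫ x, bumpDensity x * logMax (Real.exp t • x + z)
        ≤ ∫ x, bumpDensity x * (t + Real.log (2 + ‖z‖)) := by
          refine integral_mono (integrable_mul_of_testFunction _ (continuous_logMax.comp
            (by fun_prop))) ((integrable_testFunction _).mul_const _) fun x => ?_
          rcases le_or_gt 1 ‖x‖ with hx | hx
          · simp [bumpDensity_apply, bump_eq_zero hx]
          · refine mul_le_mul_of_nonneg_left ?_ (bumpDensity_nonneg x)
            have hz := norm_nonneg z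
            have e : t + Real.log (2 + ‖z‖) = Real.log (Real.exp t * (2 + ‖z‖)) := by
              rw [Real.log_mul (Real.exp_pos t).ne' (by positivity), Real.log_exp]
            rw [e, logMax]
            refine Real.log_le_log (lt_max_of_lt_right one_pos) (max_le ?_ (by nlinarith))
            refine (norm_add_le _ _).trans ?_
            rw [norm_smul, Real.norm_of_nonneg (Real.exp_pos t).le]
            nlinarith [mul_le_of_le_one_right (Real.exp_pos t).le hx.le]
      _ = t + Real.log (2 + ‖z‖) := by
          rw [integral_mul_const, integral_bumpDensity, one_mul]
  linarith

/-- At large scales the deterministic drift `q log r` dominates the fluctuations of the average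
of the field, whose variance is of order `log r`. -/
lemma IsWholePlaneGFF.exists_measure_affineComp_lt_le (hP : IsWholePlaneGFF P id)
    (z : ℂ) {q : ℝ} (hq : 0 < q) (M : ℝ) {δ : ℝ}
    (hδ : 0 < δ) : ∃ (r : ℝ) (hr : 0 < r),
      P {T | affineComp r hr z T bumpDensity + q * Real.log r < M} ≤ ENNReal.ofReal δ := by
  have := hP.isProbabilityMeasure
  obtain ⟨A, hA⟩ := hP.variance_affineComp_le z
  set t := |2 * M / q| + |A| + 8 / (δ * q ^ 2) + 1 with ht
  have h8 : 0 < 8 / (δ * q ^ 2) := by positivity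
  have ht0 : 0 < t := by positivity
  have hM : M ≤ q * t / 2 := by
    have h1 : 2 * M / q ≤ t := by
      have := le_abs_self (2 * M / q)
      have := abs_nonneg A
      linarith
    rw [div_le_iff₀ hq] at h1
    linarith
  have htA : t + A ≤ 2 * t := by
    have := le_abs_self A
    have := abs_nonneg (2 * M / q)
    linarith
  have h2t : 2 * t ≤ δ * (q * t / 2) ^ 2 := by
    have h1 : 8 / (δ * q ^ 2) ≤ t := by
      have := abs_nonneg (2 * M / q)
      have := abs_nonneg A
      linarith
    rw [div_le_iff₀ (by positivity)] at h1
    nlinarith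
  have hc : 0 < q * t / 2 := by positivity
  have hmem : MemLp (fun T => affineComp (Real.exp t) (Real.exp_pos t) z T bumpDensity) 2 P := by
    simp only [affineComp_apply]
    exact (hP.hasGaussianLaw _).memLp_two
  have hmean : ∫ T, affineComp (Real.exp t) (Real.exp_pos t) z T bumpDensity ∂P = 0 := by
    simp only [affineComp_apply]
    exact hP.centered _
  refine ⟨Real.exp t, Real.exp_pos t, ?_⟩
  calc P {T | affineComp (Real.exp t) (Real.exp_pos t) z T bumpDensity +
        q * Real.log (Real.exp t) < M}
      ≤ P {T | q * t / 2 ≤ |affineComp (Real.exp t) (Real.exp_pos t) z T bumpDensity -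
          ∫ T, affineComp (Real.exp t) (Real.exp_pos t) z T bumpDensity ∂P|} := by
        refine measure_mono fun T hT => ?_
        change _ < M at hT
        change q * t / 2 ≤ |_ - _|
        rw [Real.log_exp] at hT
        rw [hmean, sub_zero]
        refine le_trans ?_ (neg_le_abs _)
        linarith
    _ ≤ _ := meas_ge_le_variance_div_sq hmem hc
    _ ≤ ENNReal.ofReal δ := by
        refine ENNReal.ofReal_le_ofReal ?_
        rw [div_le_iff₀ (by positivity)]
        exact (hA t ht0.le).trans (htA.trans h2t)

end GFF

/-! ### Metrics of the Gaussian free field -/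

section Metric

variable {γ ξ : ℝ} {D : PlaneDistribution → PlaneMetric} {P : Measure PlaneDistribution}

lemma IsWholePlaneGFF.isGFFPlusContinuous (hP : IsWholePlaneGFF P id) :
    IsGFFPlusContinuous P id :=
  ⟨id, fun _ => 0, hP, fun _ => measurable_const, fun T => by
    rw [ofContinuous_zero, add_zero]⟩

lemma IsLQGMetric.measurable_dist (hD : IsLQGMetric γ ξ D) (x y : ℂ) :
    Measurable fun T => (D T).dist x y :=
  ((comap_measurable (fun d : PlaneMetric => d.dist x y)).mono (le_iSup (fun p : ℂ × ℂ =>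
    MeasurableSpace.comap (fun d : PlaneMetric => d.dist p.1 p.2) inferInstance) (x, y))
      le_rfl).comp hD.measurable

lemma IsLQGMetric.ae_weyl_scaling (hD : IsLQGMetric γ ξ D) (hP : IsWholePlaneGFF P id) :
    ∀ᵐ T ∂P, ∀ (f : C(ℂ, ℝ)) (z w : ℂ),
    (D T).weyl ξ f z w = ENNReal.ofReal ((D (T + ofContinuous f)).dist z w) := by
  have := hP.isProbabilityMeasure
  exact hD.weyl_scaling P id hP.isGFFPlusContinuous

lemma weyl_zero_of_weyl_scaling {T : PlaneDistribution} (hT : ∀ (f : C(ℂ, ℝ)) (z w : ℂ),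
    (D T).weyl ξ f z w = ENNReal.ofReal ((D (T + ofContinuous f)).dist z w)) (x y : ℂ) :
    (D T).weyl ξ 0 x y = ENNReal.ofReal ((D T).dist x y) := by
  rw [hT, ofContinuous_zero, add_zero]

lemma dist_add_const_of_weyl_scaling (hξ : 0 ≤ ξ) {T : PlaneDistribution}
    (hT : ∀ (f : C(ℂ, ℝ)) (z w : ℂ),
      (D T).weyl ξ f z w = ENNReal.ofReal ((D (T + ofContinuous f)).dist z w)) (c : ℝ) (x y : ℂ) :
    (D (T + ofContinuous (ContinuousMap.const ℂ c))).dist x y =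
      Real.exp (ξ * c) * (D T).dist x y := by
  have h := hT (ContinuousMap.const ℂ c) x y
  rw [PlaneMetric.weyl_const _ hξ, weyl_zero_of_weyl_scaling hT,
    ← ENNReal.ofReal_mul (Real.exp_pos _).le] at h
  exact ((ENNReal.ofReal_eq_ofReal_iff (mul_nonneg (Real.exp_pos _).le
    (PlaneMetric.dist_nonneg _ _ _)) (PlaneMetric.dist_nonneg _ _ _)).1 h).symm

/-- Large circles around `z` are far from `z` with high probability. The field seen at scale `r` is
in law the recentered field plus a constant which is large with high probability, and adding a
constant to the field multiplies distances by a factor. -/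
lemma IsLQGMetric.exists_measure_sphere_le (hD : IsLQGMetric γ ξ D) (hP : IsWholePlaneGFF P id)
    (hγ : 0 < γ) (hξ : 0 < ξ) (z : ℂ) (K : ℝ) {δ : ℝ}
    (hδ : 0 < δ) : ∃ r > 0, P {T | ¬ ∀ x ∈ Metric.sphere z r, K ≤ (D T).dist z x} ≤
      ENNReal.ofReal δ + ENNReal.ofReal δ := by
  have := hP.isProbabilityMeasure
  set v : ℕ → Circle := denseSeq Circle
  have hcirc : ∀ d : PlaneMetric, Continuous fun u : Circle => d.dist 0 u := fun d =>
    d.continuous_dist.comp (continuous_const.prodMk continuous_subtype_val)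
  let S : Set PlaneDistribution := {T | ∀ n, K ≤ (D T).dist 0 (v n)}
  have hS : MeasurableSet S := by
    simp only [S, ofPred_forall]
    exact MeasurableSet.iInter fun n => measurableSet_le measurable_const (hD.measurable_dist _ _)
  have hSall : ∀ T ∈ S, ∀ u : Circle, K ≤ (D T).dist 0 u := by
    intro T hT u
    have hcl : IsClosed {u : Circle | K ≤ (D T).dist 0 u} :=
      isClosed_le continuous_const (hcirc (D T))
    have : closure (range v) ⊆ {u : Circle | K ≤ (D T).dist 0 u} :=
      closure_minimal (range_subset_iff.2 hT) hcl
    exact this (denseRange_denseSeq Circle u)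
  -- the circle is at positive distance from its center
  let S' : ℕ → Set PlaneDistribution := fun n =>
    {T | ∃ m, Real.exp (ξ * -T bumpDensity) * (D T).dist 0 (v m) < 1 / ((n : ℝ) + 1)}
  have hS'm : ∀ n, MeasurableSet (S' n) := fun n => by
    simp only [S', ofPred_exists]
    refine MeasurableSet.iUnion fun m => measurableSet_lt (Measurable.mul ?_
      (hD.measurable_dist _ _)) measurable_const
    exact Real.measurable_exp.comp ((measurable_eval bumpDensity).neg.const_mul ξ)
  have hS'anti : Antitone S' := by
    intro n n' hn T hT
    obtain ⟨m, hm⟩ := hT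
    refine ⟨m, hm.trans_le ?_⟩
    have : (n : ℝ) ≤ n' := by exact_mod_cast hn
    gcongr
  have hS'empty : ⋂ n, S' n = ∅ := by
    rw [eq_empty_iff_forall_notMem]
    intro T hT
    rw [mem_iInter] at hT
    obtain ⟨u, -, hu⟩ := isCompact_univ.exists_isMinOn univ_nonempty (hcirc (D T)).continuousOn
    have hpos : 0 < (D T).dist 0 u := lt_of_le_of_ne ((D T).dist_nonneg _ _) fun h =>
      u.coe_ne_zero ((D T).eq_of_dist_eq_zero _ _ h.symm).symm
    obtain ⟨n, hn⟩ := exists_nat_one_div_lt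
      (mul_pos (Real.exp_pos (ξ * -T bumpDensity)) hpos)
    obtain ⟨m, hm⟩ := hT n
    have h1 := mul_le_mul_of_nonneg_left (hu (mem_univ (v m)))
      (Real.exp_pos (ξ * -T bumpDensity)).le
    exact absurd (hm.trans hn) (not_lt.2 h1)
  have hlim := tendsto_measure_iInter_atTop (μ := P) (fun n => (hS'm n).nullMeasurableSet) hS'anti
    ⟨0, measure_ne_top _ _⟩
  rw [hS'empty, measure_empty] at hlim
  obtain ⟨n, hn⟩ := (hlim.eventually (gt_mem_nhds (ENNReal.ofReal_pos.2 hδ))).exists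
  -- the constant for which `exp (ξ M) / (n + 1) = max K 1`
  set M := Real.log (max K 1 * ((n : ℝ) + 1)) / ξ with hM
  have hq : 0 < 2 / γ + γ / 2 := by positivity
  obtain ⟨r, hr, hrM⟩ := hP.exists_measure_affineComp_lt_le z hq M hδ
  refine ⟨r, hr, ?_⟩
  set c : PlaneDistribution → ℝ := fun T =>
    affineComp r hr z T bumpDensity + (2 / γ + γ / 2) * Real.log r with hc
  have hcm : Measurable c :=
    ((measurable_eval bumpDensity).comp (measurable_affineComp hr z)).add measurable_const
  have hm := measurable_recenter.comp (measurable_affineComp hr z)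
  -- under `ν`, the first coordinate is the field, and the second one is coupled to its recentering
  -- in the way in which `c` is coupled to the recentered field at scale `r`
  obtain ⟨ν, hν₁, hν₂⟩ := exists_measure_prod_of_map_eq measurable_recenter hm hcm
    (hP.map_recenter_affineComp hr z)
  have hgm : Measurable fun p : PlaneDistribution × ℝ => (recenter p.1, p.2) :=
    (measurable_recenter.comp measurable_fst).prodMk measurable_snd
  let B : Set (PlaneDistribution × ℝ) := {p | p.1 + ofContinuous (ContinuousMap.const ℂ p.2) ∈ Sᶜ}
  have hB : MeasurableSet B := measurable_add_const hS.compl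
  have h₁ : P {T | ¬ ∀ x ∈ Metric.sphere z r, K ≤ (D T).dist z x} ≤
      P ((fun T => (recenter (affineComp r hr z T), c T)) ⁻¹' B) := by
    refine measure_mono_ae ?_
    filter_upwards [hD.coordinate_change P id hP.isGFFPlusContinuous r hr z] with T hT hbad hS'
    refine hbad fun x hx => ?_
    change recenter (affineComp r hr z T) + ofContinuous (ContinuousMap.const ℂ (c T)) ∈ S at hS'
    rw [hc, recenter_add_const] at hS'
    have hx' : ‖x - z‖ = r := by rwa [mem_sphere_iff_norm] at hx
    have hu : (x - z) / r ∈ Submonoid.unitSphere ℂ := by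
      change _ ∈ Metric.sphere (0 : ℂ) 1
      rw [mem_sphere_zero_iff_norm, norm_div, hx', Complex.norm_real, Real.norm_of_nonneg hr.le,
        div_self hr.ne']
    have h2 := hSall _ hS' ⟨(x - z) / r, hu⟩
    have h3 := hT 0 ((x - z) / r)
    rw [mul_zero, zero_add, mul_div_cancel₀ _ (Complex.ofReal_ne_zero.2 hr.ne'),
      sub_add_cancel] at h3
    change K ≤ (D T).dist z x
    exact h2.trans h3.ge
  have h₂ : P ((fun T => (recenter (affineComp r hr z T), c T)) ⁻¹' B) =
      ν ((fun p : PlaneDistribution × ℝ => (recenter p.1, p.2)) ⁻¹' B) := by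
    rw [← Measure.map_apply hgm hB, hν₂]
    exact (Measure.map_apply (hm.prodMk hcm) hB).symm
  have h₃ : ν ((fun p : PlaneDistribution × ℝ => (recenter p.1, p.2)) ⁻¹' B) ≤
      ν ({p | p.2 < M} ∪ Prod.fst ⁻¹' S' n) := by
    have hw : ∀ᵐ p ∂ν, ∀ (f : C(ℂ, ℝ)) (z w : ℂ),
        (D p.1).weyl ξ f z w = ENNReal.ofReal ((D (p.1 + ofContinuous f)).dist z w) := by
      have := hD.ae_weyl_scaling hP
      rw [← hν₁] at this
      exact ae_of_ae_map measurable_fst.aemeasurable this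
    refine measure_mono_ae ?_
    filter_upwards [hw] with p hp hpB
    by_contra hcon
    have hcon' : ¬ (p.2 < M ∨ p.1 ∈ S' n) := hcon
    rw [not_or, not_lt] at hcon'
    obtain ⟨hpM, hpS⟩ := hcon'
    refine hpB fun m => ?_
    change K ≤ (D (recenter p.1 + ofContinuous (ContinuousMap.const ℂ p.2))).dist 0 (v m)
    rw [recenter, add_const_add_const, dist_add_const_of_weyl_scaling hξ.le hp, mul_add,
      Real.exp_add, mul_comm (Real.exp (ξ * -p.1 bumpDensity)), mul_assoc]
    have h4 : 1 / ((n : ℝ) + 1) ≤ Real.exp (ξ * -p.1 bumpDensity) * (D p.1).dist 0 (v m) := by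
      by_contra h
      exact hpS ⟨m, not_le.1 h⟩
    have h5 : max K 1 * ((n : ℝ) + 1) ≤ Real.exp (ξ * p.2) := by
      have hpos : 0 < max K 1 * ((n : ℝ) + 1) :=
        mul_pos (lt_max_of_lt_right one_pos) (by positivity)
      rw [← Real.log_le_iff_le_exp hpos, mul_comm ξ, ← div_le_iff₀ hξ]
      exact hpM
    calc K ≤ max K 1 * ((n : ℝ) + 1) * (1 / ((n : ℝ) + 1)) := by
          rw [mul_assoc, mul_one_div_cancel (by positivity), mul_one]
          exact le_max_left _ _
      _ ≤ _ := mul_le_mul h5 h4 (by positivity) (Real.exp_pos _).le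
  have h₄ : ν {p | p.2 < M} ≤ ENNReal.ofReal δ := by
    have hms : MeasurableSet {p : PlaneDistribution × ℝ | p.2 < M} :=
      measurableSet_lt measurable_snd measurable_const
    have h5 := Measure.map_apply (μ := ν) hgm hms
    rw [hν₂, Measure.map_apply (hm.prodMk hcm) hms] at h5
    exact h5.symm.le.trans hrM
  have h₅ : ν (Prod.fst ⁻¹' S' n) ≤ ENNReal.ofReal δ := by
    rw [← Measure.map_apply measurable_fst (hS'm n), hν₁]
    exact hn.le
  exact h₁.trans (h₂.le.trans (h₃.trans ((measure_union_le _ _).trans (add_le_add h₄ h₅))))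

/-- Almost surely, the `D_h`-balls around a fixed point are bounded. -/
lemma IsLQGMetric.ae_hasBoundedBalls (hD : IsLQGMetric γ ξ D) (hP : IsWholePlaneGFF P id)
    (hγ : 0 < γ) (hξ : 0 < ξ) (z : ℂ) :
    ∀ᵐ T ∂P, (D T).HasBoundedBalls z := by
  have h : ∀ᵐ T ∂P, ∀ K : ℕ, ∃ r > 0, ∀ x ∈ Metric.sphere z r, (K : ℝ) ≤ (D T).dist z x := by
    rw [ae_all_iff]
    intro K
    refine le_antisymm (ENNReal.le_of_forall_pos_le_add fun ε hε _ => ?_) bot_le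
    obtain ⟨r, hr, h⟩ := hD.exists_measure_sphere_le hP hγ hξ z K (δ := ε / 2) (by positivity)
    have e : ENNReal.ofReal (ε / 2) + ENNReal.ofReal (ε / 2) = ε := by
      rw [← ENNReal.ofReal_add (by positivity) (by positivity), add_halves,
        ENNReal.ofReal_coe_nnreal]
    rw [e] at h
    rw [zero_add]
    refine (measure_mono fun T hT => ?_).trans h
    exact fun hr' => hT ⟨r, hr, hr'⟩
  filter_upwards [h, hD.ae_weyl_scaling hP] with T hT hw
  refine PlaneMetric.hasBoundedBalls_of_sphere
    (PlaneMetric.hasApproxGeodesics_of_weyl (weyl_zero_of_weyl_scaling hw)) fun K => ?_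
  obtain ⟨n, hn⟩ := exists_nat_ge K
  obtain ⟨r, hr, h⟩ := hT n
  exact ⟨r, hr, fun x hx => hn.trans (h x hx)⟩

end Metric

/-! ### Uniqueness of geodesics -/

lemma HasConcaveKink.of_comp_add {g : ℝ → ℝ} {s : ℝ}
    (h : HasConcaveKink (fun t => g (s + t)) 0) : HasConcaveKink g s := by
  obtain ⟨n, m, h⟩ := h
  refine ⟨n, m, fun k hk => ?_⟩
  have := h k hk
  simp only [zero_add, zero_sub, add_zero] at this
  rwa [← sub_eq_add_neg] at this

lemma measurableSet_hasConcaveKink {α : Type*} [MeasurableSpace α] {G : α → ℝ → ℝ}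
    (hG : ∀ s, Measurable fun a => G a s) (s : ℝ) : MeasurableSet {a | HasConcaveKink (G a) s} := by
  simp only [HasConcaveKink, ofPred_exists, ofPred_forall]
  refine MeasurableSet.iUnion fun n => MeasurableSet.iUnion fun m => MeasurableSet.iInter fun k =>
    MeasurableSet.iInter fun _ => measurableSet_le ?_ measurable_const
  exact (((hG _).add (hG _)).sub ((hG _).const_mul 2)).const_mul _

section

variable {γ ξ : ℝ} {D : PlaneDistribution → PlaneMetric} {P : Measure PlaneDistribution}

/-- Almost surely, all geodesics between two fixed points have the same `f`-integral, where `f` is a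
bounded Green potential. If not, the distance would have a concave kink at the field itself, on the
line in direction `f`; but its logarithm is Lipschitz along such lines. -/
lemma IsLQGMetric.ae_integral_eq (hD : IsLQGMetric γ ξ D) (hP : IsWholePlaneGFF P id) (hξ : 0 < ξ)
    {z w : ℂ} (hzw : z ≠ w) {ψ : 𝓓((⊤ : Opens ℂ), ℝ)} {f : C(ℂ, ℝ)}
    (hf : ∀ x, f x = greenPotential ψ x) (hne : ∃ x, greenPotential ψ x ≠ 0) {M : ℝ}
    (hM : ∀ x, |f x| ≤ M) :
    ∀ᵐ T ∂P, ∀ P₁ P₂ : ℝ → ℂ, (D T).IsLengthParam z w ((D T).dist z w) P₁ →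
      (D T).IsLengthParam z w ((D T).dist z w) P₂ →
      ∫ t in Icc 0 ((D T).dist z w), f (P₁ t) = ∫ t in Icc 0 ((D T).dist z w), f (P₂ t) := by
  let G : PlaneDistribution → ℝ → ℝ := fun T s => (D (T + ofContinuous (s • f))).dist z w
  have hGm : ∀ s, Measurable fun T => G T s := fun s => by
    refine (hD.measurable_dist z w).comp (measurable_distribution_iff.2 fun φ => ?_)
    simp only [add_apply]
    exact (measurable_eval φ).add_const _
  have hshift : ∀ T s t, G (T + ofContinuous (s • f)) t = G T (s + t) := fun T s t => by
    simp only [G]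
    rw [add_smul, ofContinuous_add, add_assoc]
  have hw := hD.ae_weyl_scaling hP
  have hline : ∀ᵐ T ∂P, ∀ᵐ s : ℝ, T + ofContinuous (s • f) ∉ {T | HasConcaveKink (G T) 0} := by
    filter_upwards [hw] with T hT
    have hpos : ∀ s, 0 < G T s := fun s => lt_of_le_of_ne (PlaneMetric.dist_nonneg _ _ _)
      fun h => hzw (PlaneMetric.eq_of_dist_eq_zero _ _ _ h.symm)
    have hlip : ∀ s t, G T s ≤ Real.exp (ξ * M * |s - t|) * G T t := by
      intro s t
      have h1 := (D T).weyl_le_mul hξ.le (f := s • f) (g := t • f) (c := M * |s - t|)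
        (fun x => by
          have h2 : (s - t) * f x ≤ |s - t| * M := by
            refine (le_abs_self _).trans ?_
            rw [abs_mul]
            exact mul_le_mul_of_nonneg_left (hM x) (abs_nonneg _)
          simp only [ContinuousMap.smul_apply, smul_eq_mul]
          linarith) z w
      rw [hT, hT, ← ENNReal.ofReal_mul (Real.exp_pos _).le, ← mul_assoc] at h1
      exact (ENNReal.ofReal_le_ofReal_iff (mul_nonneg (Real.exp_pos _).le (hpos t).le)).1 h1
    filter_upwards [ae_not_hasConcaveKink hpos hlip] with s hs hmem
    refine hs (HasConcaveKink.of_comp_add ?_)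
    have h1 : HasConcaveKink (G (T + ofContinuous (s • f))) 0 := hmem
    rwa [funext (hshift T s)] at h1
  filter_upwards [hw, hP.ae_notMem_of_ae_line hf hne (measurableSet_hasConcaveKink hGm 0) hline]
    with T hT hkink P₁ P₂ h₁ h₂
  have hG0 : G T 0 = (D T).dist z w := by
    simp only [G]
    rw [zero_smul, ofContinuous_zero, add_zero]
  rcases lt_trichotomy (∫ t in Icc 0 ((D T).dist z w), f (P₁ t))
    (∫ t in Icc 0 ((D T).dist z w), f (P₂ t)) with h | h | h
  · exact absurd (PlaneMetric.hasConcaveKink_of_integral_lt hξ hM hG0 (fun s => hT _ z w) h₁ h₂ h)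
      hkink
  · exact h
  · exact absurd (PlaneMetric.hasConcaveKink_of_integral_lt hξ hM hG0 (fun s => hT _ z w) h₂ h₁ h)
      hkink

theorem IsLQGMetric.ae_hasUniqueGeodesic (hD : IsLQGMetric γ ξ D) (hP : IsWholePlaneGFF P id)
    (hγ : 0 < γ) (hξ : 0 < ξ) {z w : ℂ} (hzw : z ≠ w) :
    ∀ᵐ T ∂P, (D T).HasUniqueGeodesic z w := by
  obtain ⟨I, hIc, hI⟩ := TopologicalSpace.exists_countable_dense ℂ
  have hsep : ∀ᵐ T ∂P, ∀ c ∈ I, ∀ q : ℚ, 0 < q → ∃ (f : ℂ → ℝ) (C : ℝ), Continuous f ∧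
      (∀ x ∉ Metric.ball c (q : ℝ), f x = C) ∧ (∀ x ∈ Metric.ball c (q : ℝ), C < f x) ∧
      ∀ P₁ P₂ : ℝ → ℂ, (D T).IsLengthParam z w ((D T).dist z w) P₁ →
        (D T).IsLengthParam z w ((D T).dist z w) P₂ →
        ∫ t in Icc 0 ((D T).dist z w), f (P₁ t) = ∫ t in Icc 0 ((D T).dist z w), f (P₂ t) := by
    refine (ae_ball_iff hIc).2 fun c _ => ae_all_iff.2 fun q => ?_
    by_cases hq : 0 < q
    · have hq' : (0 : ℝ) < q := by exact_mod_cast hq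
      obtain ⟨ψ, C, M, hM, hout, hin⟩ := exists_greenPotential_bump c hq'
      have hne : ∃ x, greenPotential ψ x ≠ 0 := by
        by_contra! h
        have h1 := hin c (Metric.mem_ball_self hq')
        have h2 := hout (c + (q : ℝ)) (by simp [le_abs_self])
        rw [h] at h1 h2
        exact h1.ne h2.symm
      filter_upwards [hD.ae_integral_eq hP hξ hzw
        (f := ⟨greenPotential ψ, continuous_greenPotential ψ⟩) (fun _ => rfl) hne hM] with T hT _
      exact ⟨greenPotential ψ, C, continuous_greenPotential ψ, hout, hin, hT⟩
    · exact Filter.Eventually.of_forall fun T h => absurd h hq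
  filter_upwards [hsep, hD.ae_weyl_scaling hP, hD.ae_hasBoundedBalls hP hγ hξ z] with T hT hw hb
  refine PlaneMetric.hasUniqueGeodesic_of_eqOn
    (PlaneMetric.hasApproxGeodesics_of_weyl (weyl_zero_of_weyl_scaling hw)) hb
    fun P₁ P₂ h₁ h₂ => PlaneMetric.eqOn_of_integral_eq hI h₁ h₂ fun c hc q hq => ?_
  obtain ⟨f, C, hf, hout, hin, heq⟩ := hT c hc q hq
  exact ⟨f, C, hf, hout, hin, heq P₁ P₂ h₁ h₂⟩

end

/-- The law of a whole-plane GFF is the law under which the canonical field is one. -/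
lemma IsWholePlaneGFF.map {Ω : Type*} [MeasurableSpace Ω] {μ : Measure Ω}
    {h : Ω → PlaneDistribution} (hh : IsWholePlaneGFF μ h) : IsWholePlaneGFF (μ.map h) id where
  measurable := measurable_id
  gaussian := by
    refine ⟨fun I => ⟨?_⟩⟩
    have hm : Measurable fun T : PlaneDistribution =>
        I.restrict fun φ : 𝓓((⊤ : Opens ℂ), ℝ) => T φ :=
      (Finset.measurable_restrict I).comp measurable_eval_pi
    have h1 := (hh.gaussian.hasGaussianLaw I).isGaussian_map
    have h2 := Measure.map_map (μ := μ) hm hh.measurable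
    change IsGaussian ((μ.map h).map _)
    simp only [id]
    rw [h2]
    exact h1
  centered φ := by
    have h1 := integral_map (μ := μ) hh.measurable.aemeasurable
      (measurable_eval φ).aestronglyMeasurable
    exact h1.trans (hh.centered φ)
  covariance_eq φ ψ := by
    have h1 := covariance_map (μ := μ) (Z := h) (measurable_eval φ).aestronglyMeasurable
      (measurable_eval ψ).aestronglyMeasurable hh.measurable.aemeasurable
    exact h1.trans (hh.covariance_eq φ ψ)

end LQG

/-- For distinct fixed points `z` and `w`, almost surely there is a unique `D_h`-geodesic from `z`
to `w`, where `D` is an LQG metric and `h` is a whole-plane GFF. -/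
theorem lemma4p2 {γ ξ : ℝ} (hγ : γ ∈ Set.Ioo (0 : ℝ) 2) (hξ : 0 < ξ)
    (D : LQG.PlaneDistribution → LQG.PlaneMetric) (hD : LQG.IsLQGMetric γ ξ D)
    {Ω : Type*} [MeasurableSpace Ω] (μ : MeasureTheory.Measure Ω)
    [MeasureTheory.IsProbabilityMeasure μ]
    (h : Ω → LQG.PlaneDistribution) (hh : LQG.IsWholePlaneGFF μ h)
    (z w : ℂ) (hzw : z ≠ w) :
    ∀ᵐ ω ∂μ, (D (h ω)).HasUniqueGeodesic z w :=
  ae_of_ae_map hh.measurable.aemeasurable (hD.ae_hasUniqueGeodesic hh.map hγ.1 hξ hzw)
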